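/- Let $\mathbb R^{1,n-1}$ be $n$-dimensional Minkowski space with scalar product $\langle\cdot,\cdot\rangle$ of signature $(-,+,\dots,+)$. The space $\mathcal J_{n-1}$ of null affine hyperplanes $H(u,c)=\{x:\langle x,u\rangle=c\}$ is identified with the set of pairs $(u,c)$, where $c\in\mathbb R$ and $u$ is a future oriented null vector of Euclidean norm $1$, and carries the corresponding topology. For $\Lambda\subset\mathcal J_{n-1}$ put $E^+(\Lambda)=\{x:\langle x,u\rangle<c \text{ for all } H(u,c)\in\Lambda\}$. A future complete flat regular domain is a set $E^+(\Lambda)\neq\emptyset$ with $\Lambda$ closed and containing at least two elements. Its cosmological time $\tau(x)\in[0,+\infty]$ is the supremum of the Lorentzian lengths of the past oriented causal curves in $E^+(\Lambda)$ starting at $x$. For a smooth spacelike hypersurface with future oriented unit normal $\nu$, let $\mathrm{II}(X,Y)=-\langle\nabla_X\nu,Y\rangle$, and let the mean curvature be $\operatorname{tr}\mathrm{II}/(n-1)$ (so future hyperboloids have negative mean curvature). A subset $S$ of a spacetime $M$ is a $C^0$-spacelike hypersurface if every $x\in S$ has an open neighbourhood $U$ in which $S\cap U$ is acausal and edgeless.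 For such an $S$, $x\in S$ and $c\in\mathbb R$: * $H_S(x)\le c$ means that there are a geodesically convex open neighbourhood $V$ of $x$ in $M$ and a smooth spacelike hypersurface $\mathbb S^-_x$ in $V$ with $x\in\mathbb S^-_x$, contained in the causal past of $S\cap V$ in $V$, whose mean curvature at $x$ is at most $c$; * $H_S(x)\ge c$ means that there are a geodesically convex open neighbourhood $V$ of $x$ in $M$ and a smooth spacelike hypersurface $\mathbb S^+_x$ in $V$ with $x\in\mathbb S^+_x$, contained in the causal future of $S\cap V$ in $V$, whose mean curvature at $x$ is at least $c$. **Theorem.** Let $E^+(\Lambda)\subset\mathbb R^{1,n-1}$ be a future complete flat regular domain with cosmological time $\tau$. Then $\tau>0$ on $E^+(\Lambda)$, and $\tau<+\infty$ on $E^+(\Lambda)$ if $\Lambda$ contains two non-parallel hyperplanes. For every $a\in(0,+\infty)$, the level set $S_a=\tau^{-1}(a)$ is a $C^0$-spacelike hypersurface of $E^+(\Lambda)$, and at every point of $S_a$ $$-\frac1a\;\le\;H_{S_a}\;\le\;-\frac1{(n-1)a}.$$ -/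

import Mathlib

open Set MeasureTheory
open scoped ContDiff NNReal ENNReal

noncomputable section

/-- The `n`-dimensional Minkowski space `ℝ^{1,n-1}` (time coordinate first). The product norm that
this type carries is used only for its topology and its smooth structure. -/
abbrev Minkowski (n : ℕ) : Type := ℝ × EuclideanSpace ℝ (Fin (n - 1))

namespace Minkowski

variable {n : ℕ}

/-- The Lorentzian scalar product, of signature `(-,+,…,+)`. -/
def lor (x y : Minkowski n) : ℝ := -(x.1 * y.1) + inner ℝ x.2 y.2

/-- The future oriented causal (timelike or null, nonzero) vectors. -/
def FutureCausal (v : Minkowski n) : Prop := lor v v ≤ 0 ∧ 0 < v.1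

/-- The future oriented timelike vectors. -/
def FutureTimelike (v : Minkowski n) : Prop := lor v v < 0 ∧ 0 < v.1

/-! ### Regular domains -/

/-- The future oriented null vectors of Euclidean norm one: a sphere `𝕊^{n-2}`. -/
abbrev NullDirection (n : ℕ) : Type :=
  {u : Minkowski n // lor u u = 0 ∧ 0 < u.1 ∧ u.1 ^ 2 + ‖u.2‖ ^ 2 = 1}

/-- The Penrose boundary, i.e. the space of null affine hyperplanes, with its topology: the pair
`(u, a)` stands for the null hyperplane `{x | ⟨x, u⟩ = a}`. -/
abbrev PenroseBoundary (n : ℕ) : Type := NullDirection n × ℝ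

/-- `E⁺(Λ)`: the intersection of the (open) futures of the null hyperplanes in `Λ`. -/
def futureDomain (Λ : Set (PenroseBoundary n)) : Set (Minkowski n) :=
  {x | ∀ p ∈ Λ, lor x p.1.1 < p.2}

/-- `Λ` is a future regular closed set of null hyperplanes, so that `E⁺(Λ)` is a future complete
flat regular domain. -/
structure IsFutureRegular (Λ : Set (PenroseBoundary n)) : Prop where
  isClosed : IsClosed Λ
  nontrivial : Λ.Nontrivial
  nonempty : (futureDomain Λ).Nonempty

/-! ### Curves, causality and cosmological time -/

/-- `γ : [0,1] → U` is a past oriented causal curve in `U`: Lipschitz, with past oriented causal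
velocity almost everywhere. -/
structure IsPastCausalCurve (U : Set (Minkowski n)) (γ : ℝ → Minkowski n) : Prop where
  lipschitz : ∃ K : ℝ≥0, LipschitzOnWith K γ (Icc 0 1)
  mem : ∀ t ∈ Icc (0 : ℝ) 1, γ t ∈ U
  causal : ∀ᵐ t ∂(volume.restrict (Icc (0 : ℝ) 1)), FutureCausal (-deriv γ t)

/-- `γ : [0,1] → U` is a past oriented timelike curve in `U`. -/
structure IsPastTimelikeCurve (U : Set (Minkowski n)) (γ : ℝ → Minkowski n) : Prop where
  lipschitz : ∃ K : ℝ≥0, LipschitzOnWith K γ (Icc 0 1)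
  mem : ∀ t ∈ Icc (0 : ℝ) 1, γ t ∈ U
  timelike : ∀ᵐ t ∂(volume.restrict (Icc (0 : ℝ) 1)), FutureTimelike (-deriv γ t)

/-- `y ∈ J⁻(x)` relative to `U`. -/
def CausalPast (U : Set (Minkowski n)) (y x : Minkowski n) : Prop :=
  (y = x ∧ x ∈ U) ∨ ∃ γ, IsPastCausalCurve U γ ∧ γ 0 = x ∧ γ 1 = y

/-- `y ∈ I⁻(x)` relative to `U`. -/
def ChronologicalPast (U : Set (Minkowski n)) (y x : Minkowski n) : Prop :=
  ∃ γ, IsPastTimelikeCurve U γ ∧ γ 0 = x ∧ γ 1 = y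

/-- The Lorentzian length of a causal curve defined on `[0,1]`. -/
def lorentzLength (γ : ℝ → Minkowski n) : ℝ≥0∞ :=
  ∫⁻ t in Icc (0 : ℝ) 1, ENNReal.ofReal (√(-lor (deriv γ t) (deriv γ t)))

/-- The cosmological time of the spacetime `U`, an open subset of Minkowski space: the supremum of
the lengths of the past oriented causal curves in `U` that start at `x`. -/
def cosmologicalTime (U : Set (Minkowski n)) (x : Minkowski n) : ℝ≥0∞ :=
  ⨆ (γ : ℝ → Minkowski n) (_ : IsPastCausalCurve U γ ∧ γ 0 = x), lorentzLength γ

/-- The level set `{τ = a}` of the cosmological time `τ` of `U`. -/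
def cosmologicalLevel (U : Set (Minkowski n)) (a : ℝ) : Set (Minkowski n) :=
  {x | x ∈ U ∧ cosmologicalTime U x = ENNReal.ofReal a}

/-! ### Topological spacelike hypersurfaces -/

/-- `A` is acausal in `U`: no two distinct points of `A` are joined by a causal curve in `U`. -/
def IsAcausalIn (U A : Set (Minkowski n)) : Prop :=
  ∀ x ∈ A, ∀ y ∈ A, CausalPast U y x → y = x

/-- The edge of `A` relative to `U`: the points `p` of the closure of `A` in `U` such that in every
neighbourhood `W` of `p` some timelike curve joins the future and the past of `p`
(relative to `W`) without meeting `A`. -/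
def edgeIn (U A : Set (Minkowski n)) : Set (Minkowski n) :=
  {p | p ∈ U ∧ p ∈ closure A ∧ ∀ W : Set (Minkowski n), IsOpen W → p ∈ W → W ⊆ U →
    ∃ γ, IsPastTimelikeCurve W γ ∧ ChronologicalPast W p (γ 0) ∧ ChronologicalPast W (γ 1) p ∧
      ∀ t ∈ Icc (0 : ℝ) 1, γ t ∉ A}

/-- `S` is a `C⁰`-spacelike hypersurface of the spacetime `M`. -/
def IsC0SpacelikeHypersurface (M S : Set (Minkowski n)) : Prop :=
  S ⊆ M ∧ ∀ x ∈ S, ∃ U : Set (Minkowski n), IsOpen U ∧ x ∈ U ∧ U ⊆ M ∧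
    IsAcausalIn U (S ∩ U) ∧ edgeIn U (S ∩ U) = ∅

/-! ### Smooth spacelike hypersurfaces and their mean curvature -/

/-- On the open set `W`, the set `𝕊` is a smooth hypersurface, the regular zero set of the smooth
function `f`, and its tangent hyperplanes `ker df` are spacelike. -/
structure IsSpacelikeDefiningFunction (𝕊 W : Set (Minkowski n)) (f : Minkowski n → ℝ) : Prop where
  isOpen : IsOpen W
  smooth : ContDiffOn ℝ ∞ f W
  zeroSet : 𝕊 ∩ W = {y | y ∈ W ∧ f y = 0}
  regular : ∀ y ∈ 𝕊 ∩ W, fderiv ℝ f y ≠ 0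
  spacelike : ∀ y ∈ 𝕊 ∩ W, ∀ X, fderiv ℝ f y X = 0 → X ≠ 0 → 0 < lor X X

/-- `𝕊` is a smooth (embedded) spacelike hypersurface in the open set `V`. -/
def IsSmoothSpacelikeHypersurface (V 𝕊 : Set (Minkowski n)) : Prop :=
  𝕊 ⊆ V ∧ ∀ x ∈ 𝕊, ∃ W f, x ∈ W ∧ W ⊆ V ∧ IsSpacelikeDefiningFunction 𝕊 W f

/-- The second fundamental form `II(X, Y) = -⟨∇_X ν, Y⟩` at `x`, for the normal field `ν`. -/
def secondFundamentalForm (ν : Minkowski n → Minkowski n) (x X Y : Minkowski n) : ℝ :=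
  -lor (fderiv ℝ ν x X) Y

/-- The smooth spacelike hypersurface `𝕊` has mean curvature `h = tr II / (n - 1)` at `x`. Here `ν`
is (a smooth local extension of) the future oriented unit normal field of `𝕊`, and the trace is
taken in an orthonormal basis `e` of the tangent space `ker df` at `x`. -/
def HasMeanCurvatureAt (𝕊 : Set (Minkowski n)) (x : Minkowski n) (h : ℝ) : Prop :=
  ∃ (W : Set (Minkowski n)) (f : Minkowski n → ℝ) (ν : Minkowski n → Minkowski n)
    (e : Fin (n - 1) → Minkowski n),
    x ∈ 𝕊 ∩ W ∧ IsSpacelikeDefiningFunction 𝕊 W f ∧ ContDiffOn ℝ ∞ ν W ∧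
    (∀ y ∈ 𝕊 ∩ W, lor (ν y) (ν y) = -1 ∧ 0 < (ν y).1 ∧
      ∀ X, fderiv ℝ f y X = 0 → lor (ν y) X = 0) ∧
    (∀ i, fderiv ℝ f x (e i) = 0) ∧
    (∀ i j, lor (e i) (e j) = if i = j then 1 else 0) ∧
    h = (∑ i, secondFundamentalForm ν x (e i) (e i)) / ((n : ℝ) - 1)

/-- `H_S(x) ≤ c`: near `x`, in a convex open set `V`, there is a smooth spacelike hypersurface
through `x` in the past of `S`, with mean curvature at most `c` at `x`. -/
def GenMeanCurvatureLE (M S : Set (Minkowski n)) (x : Minkowski n) (c : ℝ) : Prop :=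
  ∃ V 𝕊 : Set (Minkowski n), IsOpen V ∧ Convex ℝ V ∧ x ∈ V ∧ V ⊆ M ∧
    IsSmoothSpacelikeHypersurface V 𝕊 ∧ x ∈ 𝕊 ∧
    (∀ y ∈ 𝕊, ∃ z ∈ S ∩ V, CausalPast V y z) ∧
    ∃ h, HasMeanCurvatureAt 𝕊 x h ∧ h ≤ c

/-- `H_S(x) ≥ c`: near `x`, in a convex open set `V`, there is a smooth spacelike hypersurface
through `x` in the future of `S`, with mean curvature at least `c` at `x`. -/
def GenMeanCurvatureGE (M S : Set (Minkowski n)) (x : Minkowski n) (c : ℝ) : Prop :=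
  ∃ V 𝕊 : Set (Minkowski n), IsOpen V ∧ Convex ℝ V ∧ x ∈ V ∧ V ⊆ M ∧
    IsSmoothSpacelikeHypersurface V 𝕊 ∧ x ∈ 𝕊 ∧
    (∀ y ∈ 𝕊, ∃ z ∈ S ∩ V, CausalPast V z y) ∧
    ∃ h, HasMeanCurvatureAt 𝕊 x h ∧ c ≤ h

end Minkowski

end

/-!
Write `E` for the domain `E⁺(Λ)`; it is open, convex and closed under adding future causal vectors.
By the reverse triangle inequality segments are the longest causal curves, so `τ(x)` is the supremum
of the Lorentzian distances `√(-⟨x - q, x - q⟩)` over the points `q ∈ E` in the causal past of `x`.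
If two hyperplanes of `Λ` are not parallel, the sum of their normals is timelike, so the causal past
of `x` in the closure of `E` is compact and `τ(x)` is realised by a point `r` of that closure
(`IsFutureRegular.exists_maximizer`). Hence `τ` is finite and strictly increasing along causal
curves. It is also concave, by the reverse triangle inequality again, and therefore continuous. A
level set is then acausal by monotonicity and edgeless by the intermediate value theorem
(`IsFutureRegular.isC0SpacelikeHypersurface_level`). If all hyperplanes are parallel, `E` is a
half-space, `τ = ∞` and the level sets are empty.

For the curvature bounds at `x` with `τ(x) = a`, both barriers are of the form
`⟨Q(y - r), y - r⟩ = -a²`, with `Q` a Lorentz-orthogonal projection fixing `x - r`. Such a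
hypersurface has unit normal `Q(y - r) / a`, so its mean curvature at `x` is
`-tr(Q | (x - r)^⊥) / ((n - 1) a)`.

* From the future: `Q = id`. The hyperboloid of radius `a` about `r` lies in `{τ ≥ a}`, because the
  distance to `r` bounds `τ` from below. Its mean curvature is `-1/a`.
* From the past: `Q` is the projection to a timelike plane spanned by `x - r` and a null normal `u`.
  Maximality of `r` says that `x - r` is in the normal cone of `E` at `r`, and a Farkas lemma
  (`IsFutureRegular.exists_active_direction`) gives a hyperplane of `Λ` through `r` whose normal `u`
  satisfies that `x - r - c u` is still in the normal cone for some `c > 0`. So the cone spanned by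
  `x - r - c u` and `u` consists of normal vectors and has `x - r` in its interior relative to the
  plane. For `y` near `x` the vector `Q(y - r)` is in this cone, and a timelike normal vector bounds
  `τ(y)` from above (`cosmologicalTime_le_of_support`): the barrier lies in `{τ ≤ a}`. As only one
  tangent direction is in the plane, its mean curvature is `-1/((n - 1) a)`.
-/

noncomputable section

namespace Minkowski

variable {n : ℕ}

open Filter Topology

/-! ### The Lorentzian scalar product and the causal cone -/

/-- The Lorentzian scalar product as a continuous bilinear form. -/
def lorCLM : Minkowski n →L[ℝ] Minkowski n →L[ℝ] ℝ :=
  -((ContinuousLinearMap.mul ℝ ℝ).bilinearComp (ContinuousLinearMap.fst ℝ _ _)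
      (ContinuousLinearMap.fst ℝ _ _)) +
    (innerSL ℝ).bilinearComp (ContinuousLinearMap.snd ℝ _ _) (ContinuousLinearMap.snd ℝ _ _)

@[simp] lemma lorCLM_apply (x y : Minkowski n) : lorCLM x y = lor x y := by
  simp [lorCLM, lor]

lemma lor_comm (x y : Minkowski n) : lor x y = lor y x := by
  simp [lor, mul_comm, real_inner_comm]

lemma lor_add_left (x y z : Minkowski n) : lor (x + y) z = lor x z + lor y z := by
  simp [← lorCLM_apply]

lemma lor_add_right (x y z : Minkowski n) : lor x (y + z) = lor x y + lor x z := by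
  simp [← lorCLM_apply]

lemma lor_sub_left (x y z : Minkowski n) : lor (x - y) z = lor x z - lor y z := by
  simp [← lorCLM_apply]

lemma lor_sub_right (x y z : Minkowski n) : lor x (y - z) = lor x y - lor x z := by
  simp [← lorCLM_apply]

lemma lor_smul_left (c : ℝ) (x y : Minkowski n) : lor (c • x) y = c * lor x y := by
  simp [← lorCLM_apply]

lemma lor_smul_right (c : ℝ) (x y : Minkowski n) : lor x (c • y) = c * lor x y := by
  simp [← lorCLM_apply]

lemma lor_neg_left (x y : Minkowski n) : lor (-x) y = -lor x y := by
  simp [← lorCLM_apply]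

lemma lor_neg_right (x y : Minkowski n) : lor x (-y) = -lor x y := by
  simp [← lorCLM_apply]

@[fun_prop]
lemma continuous_lor {X : Type*} [TopologicalSpace X] {f g : X → Minkowski n}
    (hf : Continuous f) (hg : Continuous g) : Continuous fun x => lor (f x) (g x) := by
  unfold lor; fun_prop

lemma lor_self (x : Minkowski n) : lor x x = -x.1 ^ 2 + ‖x.2‖ ^ 2 := by
  simp [lor, sq]

/-- The closed future causal cone: the future oriented causal vectors and `0`. -/
def causalCone : Set (Minkowski n) := {v | ‖v.2‖ ≤ v.1}

lemma FutureCausal.mem_causalCone {v : Minkowski n} (h : FutureCausal v) : v ∈ causalCone := by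
  have := h.1
  rw [lor_self] at this
  exact (le_abs_self _).trans (abs_le_of_sq_le_sq (by linarith) h.2.le)

lemma futureCausal_of_mem {v : Minkowski n} (h : v ∈ causalCone) (h0 : v ≠ 0) :
    FutureCausal v := by
  have h1 : ‖v.2‖ ≤ v.1 := h
  have h2 := norm_nonneg v.2
  refine ⟨by rw [lor_self]; nlinarith, lt_of_le_of_ne (h2.trans h1) fun h3 => h0 ?_⟩
  have h4 : v.2 = 0 := norm_eq_zero.1 (by linarith)
  exact Prod.ext h3.symm h4

lemma FutureTimelike.futureCausal {v : Minkowski n} (h : FutureTimelike v) : FutureCausal v :=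
  ⟨h.1.le, h.2⟩

lemma futureTimelike_iff {v : Minkowski n} : FutureTimelike v ↔ ‖v.2‖ < v.1 := by
  have h2 := norm_nonneg v.2
  constructor
  · rintro ⟨h, h'⟩
    rw [lor_self] at h
    exact lt_of_pow_lt_pow_left₀ 2 h'.le (by linarith)
  · intro h
    exact ⟨by rw [lor_self]; nlinarith, by linarith⟩

lemma isOpen_futureTimelike : IsOpen {v : Minkowski n | FutureTimelike v} := by
  simp only [futureTimelike_iff]
  exact isOpen_lt (by fun_prop) (by fun_prop)

lemma lor_self_nonpos {v : Minkowski n} (h : v ∈ causalCone) : lor v v ≤ 0 := by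
  have h1 : ‖v.2‖ ≤ v.1 := h
  rw [lor_self]
  nlinarith [norm_nonneg v.2]

lemma add_mem_causalCone {v w : Minkowski n} (hv : v ∈ causalCone) (hw : w ∈ causalCone) :
    v + w ∈ causalCone :=
  (norm_add_le _ _).trans (add_le_add hv hw)

lemma smul_mem_causalCone {v : Minkowski n} {c : ℝ} (hc : 0 ≤ c) (hv : v ∈ causalCone) :
    c • v ∈ causalCone := by
  have h1 : ‖v.2‖ ≤ v.1 := hv
  change ‖c • v.2‖ ≤ c * v.1
  rw [norm_smul, Real.norm_of_nonneg hc]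
  gcongr

lemma isClosed_causalCone : IsClosed (causalCone : Set (Minkowski n)) :=
  isClosed_le (by fun_prop) (by fun_prop)

/-- A causal vector plus a timelike one is timelike. -/
lemma add_futureTimelike {v w : Minkowski n} (hv : v ∈ causalCone) (hw : FutureTimelike w) :
    FutureTimelike (v + w) := by
  rw [futureTimelike_iff] at *
  have h1 : ‖v.2‖ ≤ v.1 := hv
  exact (norm_add_le _ _).trans_lt (add_lt_add_of_le_of_lt h1 hw)

lemma lor_nonpos {v w : Minkowski n} (hv : v ∈ causalCone) (hw : w ∈ causalCone) :
    lor v w ≤ 0 := by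
  have h1 : ‖v.2‖ ≤ v.1 := hv
  have h2 : ‖w.2‖ ≤ w.1 := hw
  have := real_inner_le_norm v.2 w.2
  have := mul_le_mul h1 h2 (norm_nonneg _) ((norm_nonneg _).trans h1)
  unfold lor; linarith

lemma lor_neg {v w : Minkowski n} (hv : FutureTimelike v) (hw : FutureCausal w) :
    lor v w < 0 := by
  have h1 := futureTimelike_iff.1 hv
  have h2 : ‖w.2‖ ≤ w.1 := hw.mem_causalCone
  have := real_inner_le_norm v.2 w.2
  have := mul_le_mul_of_nonneg_left h2 (norm_nonneg v.2)
  have := mul_lt_mul_of_pos_right h1 hw.2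
  unfold lor; linarith

/-- The Lorentzian length `√(-⟨v, v⟩)` of a causal vector. -/
def lorNorm (v : Minkowski n) : ℝ := √(-lor v v)

lemma lorNorm_nonneg (v : Minkowski n) : 0 ≤ lorNorm v := Real.sqrt_nonneg _

lemma lorNorm_neg (v : Minkowski n) : lorNorm (-v) = lorNorm v := by
  simp [lorNorm, lor_neg_left, lor_neg_right]

lemma sq_lorNorm {v : Minkowski n} (h : v ∈ causalCone) : lorNorm v ^ 2 = -lor v v :=
  Real.sq_sqrt (by linarith [lor_self_nonpos h])

lemma lorNorm_pos {v : Minkowski n} (h : FutureTimelike v) : 0 < lorNorm v :=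
  Real.sqrt_pos.2 (by linarith [h.1])

lemma lorNorm_smul {c : ℝ} (hc : 0 ≤ c) (v : Minkowski n) : lorNorm (c • v) = c * lorNorm v := by
  rw [lorNorm, lor_smul_left, lor_smul_right, show -(c * (c * lor v v)) = c ^ 2 * -lor v v by ring,
    Real.sqrt_mul (sq_nonneg c), Real.sqrt_sq hc, lorNorm]

lemma futureTimelike_of_lorNorm_pos {v : Minkowski n} (h : v ∈ causalCone) (h0 : 0 < lorNorm v) :
    FutureTimelike v := by
  have h1 : 0 < -lor v v := Real.sqrt_pos.1 h0
  refine ⟨by linarith, (futureCausal_of_mem h ?_).2⟩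
  rintro rfl
  simp [lor] at h1

@[fun_prop]
lemma continuous_lorNorm : Continuous (lorNorm : Minkowski n → ℝ) := by
  unfold lorNorm; fun_prop

/-- The reverse Cauchy-Schwarz inequality. -/
lemma lorNorm_mul_le {v w : Minkowski n} (hv : v ∈ causalCone) (hw : w ∈ causalCone) :
    lorNorm v * lorNorm w ≤ -lor v w := by
  have h1 : ‖v.2‖ ≤ v.1 := hv
  have h2 : ‖w.2‖ ≤ w.1 := hw
  have h3 := real_inner_le_norm v.2 w.2
  have h4 := mul_le_mul h1 h2 (norm_nonneg _) ((norm_nonneg _).trans h1)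
  have h5 : lorNorm v * lorNorm w ≤ v.1 * w.1 - ‖v.2‖ * ‖w.2‖ := by
    refine (le_abs_self _).trans (abs_le_of_sq_le_sq ?_ (by linarith))
    rw [mul_pow, sq_lorNorm hv, sq_lorNorm hw, lor_self, lor_self]
    nlinarith [sq_nonneg (v.1 * ‖w.2‖ - w.1 * ‖v.2‖)]
  unfold lor; linarith

/-- The reverse triangle inequality. -/
lemma lorNorm_add_le {v w : Minkowski n} (hv : v ∈ causalCone) (hw : w ∈ causalCone) :
    lorNorm v + lorNorm w ≤ lorNorm (v + w) := by
  refine (le_abs_self _).trans (abs_le_of_sq_le_sq ?_ (lorNorm_nonneg _))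
  rw [sq_lorNorm (add_mem_causalCone hv hw), add_sq, sq_lorNorm hv, sq_lorNorm hw]
  have := lorNorm_mul_le hv hw
  simp only [lor_add_left, lor_add_right, lor_comm w v]
  linarith

lemma lorNorm_lt_add {v w : Minkowski n} (hv : FutureCausal v) (hw : FutureTimelike w) :
    lorNorm w < lorNorm (v + w) := by
  have hv' := hv.mem_causalCone
  have hw' := hw.futureCausal.mem_causalCone
  refine lt_of_pow_lt_pow_left₀ 2 (lorNorm_nonneg _) ?_
  rw [sq_lorNorm (add_mem_causalCone hv' hw'), sq_lorNorm hw']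
  have := lor_self_nonpos hv'
  have := lor_neg hw hv
  simp only [lor_add_left, lor_add_right, lor_comm v w]
  linarith

/-- The unit vector of the time axis. -/
def timeUnit : Minkowski n := (1, 0)

lemma futureTimelike_timeUnit : FutureTimelike (timeUnit : Minkowski n) := by
  simp [futureTimelike_iff, timeUnit]

/-! ### Displacement and length of causal curves -/

lemma IsPastTimelikeCurve.causalCurve {U : Set (Minkowski n)} {γ : ℝ → Minkowski n}
    (h : IsPastTimelikeCurve U γ) : IsPastCausalCurve U γ :=
  ⟨h.lipschitz, h.mem, h.timelike.mono fun _ ht => ht.futureCausal⟩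

section Curve

variable {U : Set (Minkowski n)} {γ : ℝ → Minkowski n}

/-- A causal velocity is nonzero, so it is not the junk value of `deriv`. -/
lemma hasDerivAt_of_futureCausal {t : ℝ} (h : FutureCausal (-deriv γ t)) :
    HasDerivAt γ (deriv γ t) t := by
  refine DifferentiableAt.hasDerivAt ?_
  by_contra h'
  simpa [deriv_zero_of_not_differentiableAt h'] using h.2

/-- The fundamental theorem of calculus along a causal curve, tested against a vector. -/
lemma IsPastCausalCurve.integral_lor (h : IsPastCausalCurve U γ) (w : Minkowski n) :
    IntegrableOn (fun t => lor (-deriv γ t) w) (Icc 0 1) ∧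
      ∫ t in Icc (0 : ℝ) 1, lor (-deriv γ t) w = lor (γ 0 - γ 1) w := by
  obtain ⟨K, hK⟩ := h.lipschitz
  set g : ℝ → ℝ := fun t => lorCLM w (γ t) with hg
  have hgL : LipschitzOnWith (‖lorCLM w‖₊ * K) g (uIcc 0 1) := by
    rw [uIcc_of_le zero_le_one]
    exact (lorCLM w).lipschitz.comp_lipschitzOnWith hK
  have hAC := hgL.absolutelyContinuousOnInterval
  have hder : ∀ᵐ t ∂(volume.restrict (Icc (0 : ℝ) 1)), -deriv g t = lor (-deriv γ t) w := by
    filter_upwards [h.causal] with t ht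
    have := ((lorCLM w).hasFDerivAt.comp_hasDerivAt t (hasDerivAt_of_futureCausal ht)).deriv
    rw [show deriv g t = _ from this, lorCLM_apply, lor_neg_left, lor_comm]
  have hi : IntegrableOn (fun t => -deriv g t) (Icc 0 1) := by
    have := hAC.intervalIntegrable_deriv
    rw [intervalIntegrable_iff_integrableOn_Icc_of_le zero_le_one] at this
    exact this.neg
  refine ⟨hi.congr hder, ?_⟩
  rw [← integral_congr_ae hder, integral_neg, integral_Icc_eq_integral_Ioc,
    ← intervalIntegral.integral_of_le zero_le_one, hAC.integral_deriv_eq_sub]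
  simp [hg, lor_sub_left, lor_comm w]

lemma IsPastCausalCurve.sub_mem_causalCone (h : IsPastCausalCurve U γ) :
    γ 0 - γ 1 ∈ causalCone := by
  have key : ∀ w ∈ (causalCone : Set (Minkowski n)), lor (γ 0 - γ 1) w ≤ 0 := by
    intro w hw
    rw [← (h.integral_lor w).2]
    exact integral_nonpos_of_ae (h.causal.mono fun t ht => lor_nonpos ht.mem_causalCone hw)
  set v := γ 0 - γ 1
  -- Testing against the null vector parallel to the spatial part bounds that part.
  have h1 := key (‖v.2‖, v.2) (le_refl ‖v.2‖)
  have h2 := key timeUnit futureTimelike_timeUnit.futureCausal.mem_causalCone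
  simp only [lor, real_inner_self_eq_norm_sq, timeUnit, mul_one, inner_zero_right] at h1 h2
  change ‖v.2‖ ≤ v.1
  rcases (norm_nonneg v.2).eq_or_lt with h0 | h0
  · linarith
  · nlinarith

/-- Among the causal curves with given endpoints, the segment is the longest. -/
lemma IsPastCausalCurve.lorentzLength_le (h : IsPastCausalCurve U γ) :
    lorentzLength γ ≤ ENNReal.ofReal (lorNorm (γ 0 - γ 1)) := by
  set v := γ 0 - γ 1 with hv
  have hvC : v ∈ causalCone := h.sub_mem_causalCone
  -- The length is at most that of every timelike vector `v + ε t` near the displacement `v`.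
  have key : ∀ ε : ℝ, 0 < ε → lorentzLength γ ≤ ENNReal.ofReal (lorNorm (v + ε • timeUnit)) := by
    intro ε hε
    set e : Minkowski n := v + ε • timeUnit with he
    have hεt : ε • timeUnit ∈ (causalCone : Set (Minkowski n)) :=
      smul_mem_causalCone hε.le futureTimelike_timeUnit.futureCausal.mem_causalCone
    have het : FutureTimelike e := add_futureTimelike hvC (by
      rw [futureTimelike_iff]; simp [timeUnit, hε])
    have hepos := lorNorm_pos het
    have heC := het.futureCausal.mem_causalCone
    obtain ⟨hi, hI⟩ := h.integral_lor e
    have hi' : IntegrableOn (fun t => -lor (-deriv γ t) e / lorNorm e) (Icc 0 1) :=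
      hi.neg.div_const _
    calc lorentzLength γ
        ≤ ∫⁻ t in Icc (0 : ℝ) 1, ENNReal.ofReal (-lor (-deriv γ t) e / lorNorm e) := by
          refine lintegral_mono_ae (h.causal.mono fun t ht => ENNReal.ofReal_le_ofReal ?_)
          rw [le_div_iff₀ hepos]
          have := lorNorm_mul_le ht.mem_causalCone heC
          rwa [lorNorm_neg] at this
      _ = ENNReal.ofReal (∫ t in Icc (0 : ℝ) 1, -lor (-deriv γ t) e / lorNorm e) := by
          refine (ofReal_integral_eq_lintegral_ofReal hi' (h.causal.mono fun t ht => ?_)).symm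
          have := lor_nonpos ht.mem_causalCone heC
          exact div_nonneg (by linarith) hepos.le
      _ ≤ ENNReal.ofReal (lorNorm e) := by
          refine ENNReal.ofReal_le_ofReal ?_
          rw [integral_div, integral_neg, hI, div_le_iff₀ hepos, ← sq, sq_lorNorm heC]
          have : lor (ε • timeUnit) e ≤ 0 := lor_nonpos hεt heC
          have h2 : lor e e = lor v e + lor (ε • timeUnit) e := by rw [← lor_add_left]
          linarith
  have hc : Tendsto (fun ε : ℝ => ENNReal.ofReal (lorNorm (v + ε • timeUnit))) (𝓝[>] 0)
      (𝓝 (ENNReal.ofReal (lorNorm v))) := by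
    have : Continuous fun ε : ℝ => ENNReal.ofReal (lorNorm (v + ε • timeUnit)) :=
      ENNReal.continuous_ofReal.comp (by fun_prop)
    have h0 := this.tendsto 0
    simp only [zero_smul, add_zero] at h0
    exact h0.mono_left nhdsWithin_le_nhds
  exact ge_of_tendsto hc (eventually_mem_nhdsWithin.mono fun ε hε => key ε hε)

end Curve

/-! ### Segments as causal curves -/

lemma hasDerivAt_segment (x y : Minkowski n) (t : ℝ) :
    HasDerivAt (fun t : ℝ => x + t • (y - x)) (y - x) t := by
  simpa using ((hasDerivAt_id t).smul_const (y - x)).const_add x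

lemma isPastCausalCurve_segment {U : Set (Minkowski n)} (hU : Convex ℝ U) {x y : Minkowski n}
    (hx : x ∈ U) (hy : y ∈ U) (h : FutureCausal (x - y)) :
    IsPastCausalCurve U (fun t : ℝ => x + t • (y - x)) where
  lipschitz := by
    refine ⟨‖y - x‖₊, LipschitzWith.lipschitzOnWith ?_⟩
    refine LipschitzWith.of_dist_le_mul fun s t => le_of_eq ?_
    rw [dist_add_left, dist_eq_norm, ← sub_smul, norm_smul, Real.dist_eq, mul_comm]; simp
  mem t ht := hU.add_smul_sub_mem hx hy ht
  causal := Eventually.of_forall fun t => by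
    rw [(hasDerivAt_segment x y t).deriv]; simpa using h

lemma lorentzLength_segment (x y : Minkowski n) :
    lorentzLength (fun t : ℝ => x + t • (y - x)) = ENNReal.ofReal (lorNorm (x - y)) := by
  simp only [lorentzLength, (hasDerivAt_segment x y _).deriv]
  rw [← neg_sub y x, lorNorm_neg]
  simp [lorNorm]

lemma causalPast_of_mem_causalCone {U : Set (Minkowski n)} (hU : Convex ℝ U) {x y : Minkowski n}
    (hx : x ∈ U) (hy : y ∈ U) (h : x - y ∈ causalCone) : CausalPast U y x := by
  by_cases h0 : x - y = 0
  · exact Or.inl ⟨(sub_eq_zero.1 h0).symm, hx⟩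
  · exact Or.inr ⟨_, isPastCausalCurve_segment hU hx hy (futureCausal_of_mem h h0), by simp,
      by simp⟩

lemma CausalPast.sub_mem_causalCone {U : Set (Minkowski n)} {x y : Minkowski n}
    (h : CausalPast U y x) : x - y ∈ causalCone := by
  rcases h with ⟨rfl, -⟩ | ⟨γ, hγ, rfl, rfl⟩
  · simp [causalCone]
  · exact hγ.sub_mem_causalCone

/-! ### Cosmological time of a convex domain -/

section ConvexDomain

variable {U : Set (Minkowski n)} {x y : Minkowski n}

lemma lorNorm_le_cosmologicalTime (hU : Convex ℝ U) (hx : x ∈ U) (hy : y ∈ U)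
    (h : x - y ∈ causalCone) : ENNReal.ofReal (lorNorm (x - y)) ≤ cosmologicalTime U x := by
  by_cases h0 : x - y = 0
  · simp [h0, lorNorm, lor]
  · rw [← lorentzLength_segment]
    exact le_iSup₂_of_le (fun t : ℝ => x + t • (y - x))
      ⟨isPastCausalCurve_segment hU hx hy (futureCausal_of_mem h h0), by simp⟩ le_rfl

lemma cosmologicalTime_le {B : ℝ} (h : ∀ y ∈ U, x - y ∈ causalCone → lorNorm (x - y) ≤ B) :
    cosmologicalTime U x ≤ ENNReal.ofReal B := by
  refine iSup₂_le fun γ ⟨hγ, h0⟩ => hγ.lorentzLength_le.trans (ENNReal.ofReal_le_ofReal ?_)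
  rw [h0]
  exact h _ (hγ.mem 1 (by simp)) (h0 ▸ hγ.sub_mem_causalCone)

lemma lorNorm_le_cosmologicalTime_of_mem_closure (hU : Convex ℝ U) (hUo : IsOpen U) (hx : x ∈ U)
    (hy : y ∈ closure U) (h : x - y ∈ causalCone) :
    ENNReal.ofReal (lorNorm (x - y)) ≤ cosmologicalTime U x := by
  have hc : Tendsto (fun s : ℝ => ENNReal.ofReal (lorNorm (x - (y + s • (x - y))))) (𝓝[>] 0)
      (𝓝 (ENNReal.ofReal (lorNorm (x - y)))) := by
    have : Continuous fun s : ℝ => ENNReal.ofReal (lorNorm (x - (y + s • (x - y)))) :=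
      ENNReal.continuous_ofReal.comp (by fun_prop)
    have h0 := this.tendsto 0
    simp only [zero_smul, add_zero] at h0
    exact h0.mono_left nhdsWithin_le_nhds
  refine le_of_tendsto hc ?_
  filter_upwards [Ioo_mem_nhdsGT (zero_lt_one : (0 : ℝ) < 1)] with s hs
  refine lorNorm_le_cosmologicalTime hU hx ?_ ?_
  · have := hU.openSegment_closure_interior_subset_interior hy (hUo.interior_eq.symm ▸ hx)
    rw [hUo.interior_eq] at this
    exact this ⟨1 - s, s, by linarith [hs.2], hs.1, by ring, by module⟩
  · rw [show x - (y + s • (x - y)) = (1 - s) • (x - y) by module]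
    exact smul_mem_causalCone (by linarith [hs.2]) h

lemma exists_sub_mem_of_isOpen (hUo : IsOpen U) (hx : x ∈ U) (v : Minkowski n) :
    ∃ ε : ℝ, 0 < ε ∧ x - ε • v ∈ U := by
  have hc : Continuous fun s : ℝ => x - s • v := by fun_prop
  have := (hc.tendsto 0).eventually (hUo.mem_nhds (by simpa using hx))
  obtain ⟨ε, h1, h2⟩ := ((this.filter_mono nhdsWithin_le_nhds).and
    (self_mem_nhdsWithin : Ioi (0 : ℝ) ∈ 𝓝[>] 0)).exists
  exact ⟨ε, h2, h1⟩

lemma cosmologicalTime_pos (hU : Convex ℝ U) (hUo : IsOpen U) (hx : x ∈ U) :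
    0 < cosmologicalTime U x := by
  obtain ⟨ε, hε, h⟩ := exists_sub_mem_of_isOpen hUo hx timeUnit
  have ht : FutureTimelike (x - (x - ε • timeUnit)) := by
    rw [sub_sub_cancel, futureTimelike_iff]; simp [timeUnit, hε]
  exact (ENNReal.ofReal_pos.2 (lorNorm_pos ht)).trans_le
    (lorNorm_le_cosmologicalTime hU hx h ht.futureCausal.mem_causalCone)

end ConvexDomain

/-! ### Geometry of regular domains -/

lemma NullDirection.mem_causalCone (u : NullDirection n) : u.1 ∈ causalCone :=
  FutureCausal.mem_causalCone ⟨u.2.1.le, u.2.2.1⟩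

lemma NullDirection.futureCausal (u : NullDirection n) : FutureCausal u.1 :=
  ⟨u.2.1.le, u.2.2.1⟩

lemma NullDirection.norm_snd (u : NullDirection n) : ‖u.1.2‖ = u.1.1 := by
  have h := u.2.1
  rw [lor_self] at h
  exact (pow_left_inj₀ (norm_nonneg _) u.2.2.1.le two_ne_zero).1 (by linarith)

instance : CompactSpace (NullDirection n) := by
  refine isCompact_iff_compactSpace.1 (Metric.isCompact_of_isClosed_isBounded ?_ ?_)
  · -- On this set the time coordinate stays away from `0`, so `0 < u.1` is a closed condition.
    have : {u : Minkowski n | lor u u = 0 ∧ 0 < u.1 ∧ u.1 ^ 2 + ‖u.2‖ ^ 2 = 1} =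
        {u | lor u u = 0 ∧ 0 ≤ u.1 ∧ u.1 ^ 2 + ‖u.2‖ ^ 2 = 1} := by
      ext u
      refine ⟨fun h => ⟨h.1, h.2.1.le, h.2.2⟩, fun h => ⟨h.1, lt_of_le_of_ne h.2.1 ?_, h.2.2⟩⟩
      intro h0
      have h1 := h.1
      have h2 := h.2.2
      rw [lor_self] at h1
      rw [← h0] at h1 h2
      linarith
    change IsClosed {u : Minkowski n | lor u u = 0 ∧ 0 < u.1 ∧ u.1 ^ 2 + ‖u.2‖ ^ 2 = 1}
    rw [this]
    simp only [ofPred_and]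
    refine (isClosed_eq ?_ ?_).inter ((isClosed_le ?_ ?_).inter (isClosed_eq ?_ ?_)) <;> fun_prop
  · refine (Metric.isBounded_closedBall (x := (0 : Minkowski n)) (r := 1)).subset ?_
    rintro u ⟨-, h0, h⟩
    rw [mem_closedBall_zero_iff, Prod.norm_def, max_le_iff, Real.norm_of_nonneg h0.le]
    constructor <;> nlinarith [sq_nonneg u.1, sq_nonneg ‖u.2‖]

variable {Λ : Set (PenroseBoundary n)}

lemma convex_futureDomain : Convex ℝ (futureDomain Λ) := by
  have : futureDomain Λ = ⋂ p ∈ Λ, {x | lorCLM p.1.1 x < p.2} := by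
    ext x; simp [futureDomain, lor_comm]
  rw [this]
  exact convex_iInter₂ fun p _ => convex_halfSpace_lt (lorCLM p.1.1).isLinear _

lemma lor_le_of_mem_closure {q : Minkowski n} (hq : q ∈ closure (futureDomain Λ))
    {p : PenroseBoundary n} (hp : p ∈ Λ) : lor q p.1.1 ≤ p.2 := by
  have hcl : IsClosed {x : Minkowski n | lor x p.1.1 ≤ p.2} :=
    isClosed_le (by fun_prop) continuous_const
  exact closure_minimal (fun x hx => (hx p hp).le) hcl hq

lemma add_mem_futureDomain {x v : Minkowski n} (hx : x ∈ futureDomain Λ) (hv : v ∈ causalCone) :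
    x + v ∈ futureDomain Λ := fun p hp => by
  have := hx p hp
  have := lor_nonpos hv p.1.mem_causalCone
  rw [lor_add_left]; linarith

/-- The hyperplanes of `Λ` of bounded height form a compact set: their heights are bounded below
because `E⁺(Λ)` has a point. -/
lemma IsFutureRegular.isCompact_sublevel (hΛ : IsFutureRegular Λ) (M : ℝ) :
    IsCompact (Λ ∩ {p | p.2 ≤ M}) := by
  obtain ⟨x₀, hx₀⟩ := hΛ.nonempty
  have hc : Continuous fun u : NullDirection n => lor x₀ u.1 := by fun_prop
  obtain ⟨m, hm⟩ := (isCompact_range hc).bddBelow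
  refine (isCompact_univ.prod (isCompact_Icc (a := m) (b := M))).of_isClosed_subset
    (hΛ.isClosed.inter (isClosed_le (by fun_prop) continuous_const)) fun p hp => ?_
  exact ⟨mem_univ _, (hm (mem_range_self p.1)).trans (hx₀ p hp.1).le, hp.2⟩

/-- To stay in `E⁺(Λ)` along a convergent family of points it is enough to check the
constraints locally near every hyperplane of `Λ`: high hyperplanes are out of reach, and the
others form a compact set. -/
lemma IsFutureRegular.eventually_mem (hΛ : IsFutureRegular Λ) {X : Type*} [TopologicalSpace X]
    [LocallyCompactSpace X] {l : Filter X} {s₀ : X} (hl : l ≤ 𝓝 s₀) {g : X → Minkowski n}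
    (hg : Continuous g)
    (h : ∀ p ∈ Λ, ∀ᶠ z : X × PenroseBoundary n in l ×ˢ 𝓝[Λ] p, lor (g z.1) z.2.1.1 < z.2.2) :
    ∀ᶠ s in l, g s ∈ futureDomain Λ := by
  have hc : Continuous fun z : X × NullDirection n => lor (g z.1) z.2.1 := by fun_prop
  obtain ⟨C, hC, hCs⟩ := exists_compact_mem_nhds s₀
  obtain ⟨M, hM⟩ := (hC.prod
    (isCompact_univ (X := NullDirection n))).bddAbove_image hc.continuousOn
  have hnear : ∀ᶠ s in l, s ∈ C := hl hCs
  have hK : ∀ᶠ s in l, ∀ p ∈ Λ ∩ {p | p.2 ≤ M}, lor (g s) p.1.1 < p.2 := by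
    refine (hΛ.isCompact_sublevel M).induction_on
      (p := fun K => ∀ᶠ s in l, ∀ p ∈ K, lor (g s) p.1.1 < p.2) (by simp) ?_ ?_ ?_
    · exact fun A B hAB hB => hB.mono fun s hs p hp => hs p (hAB hp)
    · exact fun A B hA hB => by
        filter_upwards [hA, hB] with s h1 h2 p hp
        exact hp.elim (h1 p) (h2 p)
    · intro p hp
      obtain ⟨A, hA, B, hB, hAB⟩ := mem_prod_iff.1 (h p hp.1)
      refine ⟨B, nhdsWithin_mono p inter_subset_left hB, ?_⟩
      filter_upwards [hA] with s hs q hq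
      exact hAB (show (s, q) ∈ A ×ˢ B from ⟨hs, hq⟩)
  filter_upwards [hnear, hK] with s h1 h2 p hp
  by_cases hpM : p.2 ≤ M
  · exact h2 p ⟨hp, hpM⟩
  · exact (hM (mem_image_of_mem _ (show (s, p.1) ∈ _ from ⟨h1, mem_univ _⟩))).trans_lt
      (not_le.1 hpM)

lemma IsFutureRegular.isOpen_futureDomain (hΛ : IsFutureRegular Λ) : IsOpen (futureDomain Λ) := by
  refine isOpen_iff_mem_nhds.2 fun x hx => ?_
  refine hΛ.eventually_mem (g := id) le_rfl continuous_id fun p hp => ?_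
  have hc : Continuous fun z : Minkowski n × PenroseBoundary n => z.2.2 - lor z.1 z.2.1.1 := by
    fun_prop
  have h0 : ∀ᶠ z in 𝓝 (x, p), 0 < z.2.2 - lor z.1 z.2.1.1 :=
    (hc.tendsto (x, p)).eventually (lt_mem_nhds (by simpa using hx p hp))
  rw [nhds_prod_eq] at h0
  exact (h0.filter_mono (prod_mono le_rfl nhdsWithin_le_nhds)).mono fun z hz => by
    simpa using hz

/-- Without two non-parallel hyperplanes the domain is a half-space, in which the past extends
indefinitely along the null direction of its boundary. -/
lemma IsFutureRegular.cosmologicalTime_eq_top (hΛ : IsFutureRegular Λ)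
    (hpar : ¬∃ p ∈ Λ, ∃ q ∈ Λ, p.1 ≠ q.1) {x : Minkowski n} (hx : x ∈ futureDomain Λ) :
    cosmologicalTime (futureDomain Λ) x = ⊤ := by
  obtain ⟨p, hp⟩ := hΛ.nontrivial.nonempty
  push Not at hpar
  set u := p.1.1 with hu
  have huC := p.1.mem_causalCone
  -- The other null direction of a Lorentzian plane through `u`.
  set w : Minkowski n := (u.1, -u.2) with hw
  have hu1 : 0 < u.1 := p.1.2.2.1
  have hu0 : ‖u.2‖ = u.1 := p.1.norm_snd
  have huu : lor u u = 0 := p.1.2.1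
  have hww : lor w w = 0 := by rw [lor_self] at huu ⊢; simpa [hw] using huu
  have hwu : lor w u < 0 := by
    have : 0 < u.1 * u.1 := mul_pos hu1 hu1
    simp only [hw, lor, inner_neg_left, real_inner_self_eq_norm_sq]
    nlinarith [sq_nonneg ‖u.2‖]
  have hwC : w ∈ causalCone := by simp [causalCone, hw, hu0]
  obtain ⟨ε, hε, hxε⟩ := exists_sub_mem_of_isOpen hΛ.isOpen_futureDomain hx w
  have key : ∀ s : ℝ, 0 ≤ s →
      ENNReal.ofReal √(2 * ε * s * -lor w u) ≤ cosmologicalTime (futureDomain Λ) x := by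
    intro s hs
    have hmem : x - ε • w - s • u ∈ futureDomain Λ := by
      intro q hq
      have h1 := hxε q hq
      rw [← show p.1 = q.1 from hpar p hp q hq] at h1 ⊢
      rw [lor_sub_left, lor_smul_left, huu]
      linarith
    have heq : x - (x - ε • w - s • u) = ε • w + s • u := by module
    have := lorNorm_le_cosmologicalTime convex_futureDomain hx hmem (by
      rw [heq]
      exact add_mem_causalCone (smul_mem_causalCone hε.le hwC) (smul_mem_causalCone hs huC))
    rw [heq, lorNorm] at this
    convert this using 3
    simp only [lor_add_left, lor_add_right, lor_smul_left, lor_smul_right, huu, hww, lor_comm u w]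
    ring
  refine ENNReal.eq_top_of_forall_nnreal_le fun r => ?_
  have hpos : 0 < 2 * ε * -lor w u := by nlinarith
  refine le_trans ?_ (key (r ^ 2 / (2 * ε * -lor w u)) (by positivity))
  rw [show 2 * ε * (r ^ 2 / (2 * ε * -lor w u)) * -lor w u = (r : ℝ) ^ 2 by
    have := hwu.ne; field_simp, Real.sqrt_sq r.coe_nonneg]
  simp

/-! ### The initial singularity -/

lemma lor_nullDirection_neg {u v : NullDirection n} (h : u ≠ v) : lor u.1 v.1 < 0 := by
  have hu := u.norm_snd
  have hv := v.norm_snd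
  have hu2 := u.2.2.2
  have hv2 := v.2.2.2
  rw [hu] at hu2
  rw [hv] at hv2
  have huv : u.1.1 = v.1.1 :=
    (pow_left_inj₀ u.2.2.1.le v.2.2.1.le two_ne_zero).1 (by linarith)
  have hne : u.1.2 ≠ v.1.2 := fun h' => h (Subtype.ext (Prod.ext huv h'))
  have h1 : 0 < ‖u.1.2 - v.1.2‖ ^ 2 := by
    have := norm_pos_iff.2 (sub_ne_zero.2 hne); positivity
  rw [norm_sub_sq_real, hu, hv] at h1
  unfold lor
  rw [huv] at h1 ⊢
  nlinarith

lemma exists_pos_mul_norm_le_neg_lor {t : Minkowski n} (ht : FutureTimelike t) :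
    ∃ κ : ℝ, 0 < κ ∧ ∀ v ∈ (causalCone : Set (Minkowski n)), κ * ‖v‖ ≤ -lor v t := by
  refine ⟨t.1 - ‖t.2‖, sub_pos.2 (futureTimelike_iff.1 ht), fun v hv => ?_⟩
  have hv1 : ‖v.2‖ ≤ v.1 := hv
  have hv0 := (norm_nonneg _).trans hv1
  have h1 : ‖v‖ = v.1 := by
    rw [Prod.norm_def, Real.norm_of_nonneg hv0, max_eq_left hv1]
  have := real_inner_le_norm v.2 t.2
  have := mul_le_mul_of_nonneg_right hv1 (norm_nonneg t.2)
  rw [h1]; unfold lor; linarith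

/-- With two non-parallel hyperplanes in `Λ` the causal past of a point in the closed domain is
compact, so the cosmological time is realised by a point `r` of the closure. -/
lemma IsFutureRegular.exists_maximizer (hΛ : IsFutureRegular Λ)
    (hnp : ∃ p ∈ Λ, ∃ q ∈ Λ, p.1 ≠ q.1) {x : Minkowski n} (hx : x ∈ futureDomain Λ) :
    ∃ r ∈ closure (futureDomain Λ), FutureTimelike (x - r) ∧
      cosmologicalTime (futureDomain Λ) x = ENNReal.ofReal (lorNorm (x - r)) ∧
      ∀ q ∈ closure (futureDomain Λ), x - q ∈ causalCone → lorNorm (x - q) ≤ lorNorm (x - r) := by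
  obtain ⟨p, hp, q, hq, hpq⟩ := hnp
  set J : Set (Minkowski n) := closure (futureDomain Λ) ∩ {r | x - r ∈ causalCone} with hJ
  have hJcl : IsClosed J :=
    isClosed_closure.inter (isClosed_causalCone.preimage (by fun_prop : Continuous fun r => x - r))
  have ht : FutureTimelike (p.1.1 + q.1.1) := by
    refine ⟨?_, add_pos p.1.2.2.1 q.1.2.2.1⟩
    have := lor_nullDirection_neg hpq
    simp only [lor_add_left, lor_add_right, p.1.2.1, q.1.2.1, lor_comm q.1.1]
    linarith
  obtain ⟨κ, hκ, hκb⟩ := exists_pos_mul_norm_le_neg_lor ht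
  have hJb : Bornology.IsBounded J := by
    refine (Metric.isBounded_closedBall (x := x)
      (r := (p.2 + q.2 - lor x (p.1.1 + q.1.1)) / κ)).subset fun r hr => ?_
    rw [mem_closedBall_iff_norm', le_div_iff₀ hκ, mul_comm]
    refine (hκb _ hr.2).trans ?_
    have h1 := lor_le_of_mem_closure hr.1 hp
    have h2 := lor_le_of_mem_closure hr.1 hq
    rw [lor_sub_left, lor_add_right r]
    linarith
  have hxJ : x ∈ J := ⟨subset_closure hx, by simp [causalCone]⟩
  obtain ⟨r, hr, hmax⟩ := (Metric.isCompact_of_isClosed_isBounded hJcl hJb).exists_isMaxOn ⟨x, hxJ⟩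
    (by fun_prop : Continuous fun r => lorNorm (x - r)).continuousOn
  have hmax' : ∀ q ∈ closure (futureDomain Λ), x - q ∈ causalCone →
      lorNorm (x - q) ≤ lorNorm (x - r) := fun q hq hqC => hmax (show q ∈ J from ⟨hq, hqC⟩)
  have hτ : cosmologicalTime (futureDomain Λ) x = ENNReal.ofReal (lorNorm (x - r)) :=
    le_antisymm (cosmologicalTime_le fun y hy => hmax' y (subset_closure hy))
      (lorNorm_le_cosmologicalTime_of_mem_closure convex_futureDomain hΛ.isOpen_futureDomain hx
        hr.1 hr.2)
  refine ⟨r, hr.1, futureTimelike_of_lorNorm_pos hr.2 ?_, hτ, hmax'⟩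
  have := cosmologicalTime_pos convex_futureDomain hΛ.isOpen_futureDomain hx
  rwa [hτ, ENNReal.ofReal_pos] at this

lemma IsFutureRegular.cosmologicalTime_lt_top (hΛ : IsFutureRegular Λ)
    (hnp : ∃ p ∈ Λ, ∃ q ∈ Λ, p.1 ≠ q.1) {x : Minkowski n} (hx : x ∈ futureDomain Λ) :
    cosmologicalTime (futureDomain Λ) x < ⊤ := by
  obtain ⟨r, -, -, h, -⟩ := hΛ.exists_maximizer hnp hx
  rw [h]
  exact ENNReal.ofReal_lt_top

lemma IsFutureRegular.cosmologicalTime_lt (hΛ : IsFutureRegular Λ)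
    (hnp : ∃ p ∈ Λ, ∃ q ∈ Λ, p.1 ≠ q.1) {x y : Minkowski n} (hx : x ∈ futureDomain Λ)
    (hy : y ∈ futureDomain Λ) (h : FutureCausal (x - y)) :
    cosmologicalTime (futureDomain Λ) y < cosmologicalTime (futureDomain Λ) x := by
  obtain ⟨r, hr, hrt, hτ, -⟩ := hΛ.exists_maximizer hnp hy
  have heq : x - y + (y - r) = x - r := by abel
  have h1 := lorNorm_lt_add h hrt
  have h2 := add_futureTimelike h.mem_causalCone hrt
  rw [heq] at h1 h2
  rw [hτ]
  exact ((ENNReal.ofReal_lt_ofReal_iff (lorNorm_pos h2)).2 h1).trans_le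
    (lorNorm_le_cosmologicalTime_of_mem_closure convex_futureDomain hΛ.isOpen_futureDomain hx hr
      h2.futureCausal.mem_causalCone)

/-- The cosmological time is concave: the Lorentzian distance is, by the reverse triangle
inequality, and the domain is convex. -/
lemma IsFutureRegular.concaveOn (hΛ : IsFutureRegular Λ)
    (hnp : ∃ p ∈ Λ, ∃ q ∈ Λ, p.1 ≠ q.1) :
    ConcaveOn ℝ (futureDomain Λ) fun x => (cosmologicalTime (futureDomain Λ) x).toReal := by
  refine ⟨convex_futureDomain, fun x hx y hy s t hs ht hst => ?_⟩
  obtain ⟨r, hr, hrt, hτ, -⟩ := hΛ.exists_maximizer hnp hx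
  obtain ⟨q, hq, hqt, hτ', -⟩ := hΛ.exists_maximizer hnp hy
  have hz := convex_futureDomain hx hy hs ht hst
  have hC := smul_mem_causalCone hs hrt.futureCausal.mem_causalCone
  have hC' := smul_mem_causalCone ht hqt.futureCausal.mem_causalCone
  have heq : s • x + t • y - (s • r + t • q) = s • (x - r) + t • (y - q) := by module
  have h1 := lorNorm_le_cosmologicalTime_of_mem_closure convex_futureDomain
    hΛ.isOpen_futureDomain hz (convex_futureDomain.closure hr hq hs ht hst)
    (by rw [heq]; exact add_mem_causalCone hC hC')
  rw [ENNReal.ofReal_le_iff_le_toReal (hΛ.cosmologicalTime_lt_top hnp hz).ne, heq] at h1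
  refine le_trans ?_ h1
  have h2 := lorNorm_add_le hC hC'
  rw [lorNorm_smul hs, lorNorm_smul ht] at h2
  simpa [hτ, hτ', ENNReal.toReal_ofReal (lorNorm_nonneg _)] using h2

lemma IsFutureRegular.continuousOn_cosmologicalTime (hΛ : IsFutureRegular Λ)
    (hnp : ∃ p ∈ Λ, ∃ q ∈ Λ, p.1 ≠ q.1) :
    ContinuousOn (fun x => (cosmologicalTime (futureDomain Λ) x).toReal) (futureDomain Λ) :=
  (hΛ.concaveOn hnp).continuousOn hΛ.isOpen_futureDomain

/-! ### Level sets of the cosmological time -/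

lemma mem_cosmologicalLevel_iff {U : Set (Minkowski n)} {a : ℝ} (ha : 0 < a) {x : Minkowski n} :
    x ∈ cosmologicalLevel U a ↔ x ∈ U ∧ (cosmologicalTime U x).toReal = a := by
  refine and_congr_right fun _ => ⟨fun h => by rw [h, ENNReal.toReal_ofReal ha.le], fun h => ?_⟩
  rw [← h, ENNReal.ofReal_toReal]
  intro h'
  rw [h'] at h
  exact ha.ne h

/-- Between two causally related points on either side of a level set lies a point of it. -/
lemma IsFutureRegular.exists_mem_level_between (hΛ : IsFutureRegular Λ)
    (hnp : ∃ p ∈ Λ, ∃ q ∈ Λ, p.1 ≠ q.1) {a : ℝ} (ha : 0 < a) {x y : Minkowski n}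
    (hx : x ∈ futureDomain Λ) (hy : y ∈ futureDomain Λ) (hxy : x - y ∈ causalCone)
    (hya : cosmologicalTime (futureDomain Λ) y ≤ ENNReal.ofReal a)
    (hxa : ENNReal.ofReal a ≤ cosmologicalTime (futureDomain Λ) x) :
    ∃ z ∈ cosmologicalLevel (futureDomain Λ) a, x - z ∈ causalCone ∧ z - y ∈ causalCone := by
  have hmem : ∀ s ∈ Icc (0 : ℝ) 1, y + s • (x - y) ∈ futureDomain Λ := fun s hs =>
    convex_futureDomain.add_smul_sub_mem hy hx hs
  have hc : ContinuousOn (fun s : ℝ =>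
      (cosmologicalTime (futureDomain Λ) (y + s • (x - y))).toReal) (Icc 0 1) :=
    (hΛ.continuousOn_cosmologicalTime hnp).comp
      (by fun_prop : Continuous fun s : ℝ => y + s • (x - y)).continuousOn hmem
  obtain ⟨s, hs, hsa⟩ := intermediate_value_Icc zero_le_one hc (show a ∈ Icc _ _ by
    simp only [zero_smul, add_zero, one_smul, add_sub_cancel]
    exact ⟨ENNReal.toReal_le_of_le_ofReal ha.le hya,
      (ENNReal.ofReal_le_iff_le_toReal (hΛ.cosmologicalTime_lt_top hnp hx).ne).1 hxa⟩)
  refine ⟨_, (mem_cosmologicalLevel_iff ha).2 ⟨hmem s hs, hsa⟩, ?_, ?_⟩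
  · rw [show x - (y + s • (x - y)) = (1 - s) • (x - y) by module]
    exact smul_mem_causalCone (by linarith [hs.2]) hxy
  · rw [add_sub_cancel_left]
    exact smul_mem_causalCone hs.1 hxy

lemma IsFutureRegular.cosmologicalTime_mono (hΛ : IsFutureRegular Λ)
    (hnp : ∃ p ∈ Λ, ∃ q ∈ Λ, p.1 ≠ q.1) {x y : Minkowski n} (hx : x ∈ futureDomain Λ)
    (hy : y ∈ futureDomain Λ) (h : x - y ∈ causalCone) :
    cosmologicalTime (futureDomain Λ) y ≤ cosmologicalTime (futureDomain Λ) x := by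
  by_cases h0 : x - y = 0
  · rw [sub_eq_zero.1 h0]
  · exact (hΛ.cosmologicalTime_lt hnp hx hy (futureCausal_of_mem h h0)).le

/-- Level sets are acausal since `τ` increases strictly along causal curves, and edgeless by the
intermediate value theorem along timelike curves. -/
lemma IsFutureRegular.isC0SpacelikeHypersurface_level (hΛ : IsFutureRegular Λ)
    (hnp : ∃ p ∈ Λ, ∃ q ∈ Λ, p.1 ≠ q.1) {a : ℝ} (ha : 0 < a) :
    IsC0SpacelikeHypersurface (futureDomain Λ) (cosmologicalLevel (futureDomain Λ) a) := by
  refine ⟨fun x hx => hx.1, fun x hx => ⟨futureDomain Λ, hΛ.isOpen_futureDomain, hx.1, le_rfl,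
    ?_, ?_⟩⟩
  · rintro y ⟨⟨hy, hya⟩, -⟩ z ⟨⟨hz, hza⟩, -⟩ hzy
    by_contra hne
    have := hΛ.cosmologicalTime_lt hnp hy hz
      (futureCausal_of_mem hzy.sub_mem_causalCone (sub_ne_zero.2 (Ne.symm hne)))
    rw [hya, hza] at this
    exact this.false
  · refine eq_empty_iff_forall_notMem.2 fun p ⟨hp, hpS, hW⟩ => ?_
    have hcont := hΛ.continuousOn_cosmologicalTime hnp
    have hpa : (cosmologicalTime (futureDomain Λ) p).toReal = a := by
      have h1 := (hcont p hp).mono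
        (inter_subset_right : cosmologicalLevel (futureDomain Λ) a ∩ futureDomain Λ ⊆ _)
      have := h1.mem_closure_image hpS
      refine closure_minimal ?_ isClosed_singleton this
      rintro _ ⟨y, hy, rfl⟩
      exact ((mem_cosmologicalLevel_iff ha).1 hy.1).2
    obtain ⟨γ, hγ, ⟨γ₀, hγ₀, h00, h01⟩, ⟨γ₁, hγ₁, h10, h11⟩, hmiss⟩ :=
      hW _ hΛ.isOpen_futureDomain hp le_rfl
    have hpt := (hΛ.cosmologicalTime_lt_top hnp hp).ne
    have hm0 := hγ.mem 0 (by simp)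
    have hm1 := hγ.mem 1 (by simp)
    have hC0 := hγ₀.causalCurve.sub_mem_causalCone
    have hC1 := hγ₁.causalCurve.sub_mem_causalCone
    rw [h00, h01] at hC0
    rw [h10, h11] at hC1
    have h0 := ENNReal.toReal_mono (hΛ.cosmologicalTime_lt_top hnp hm0).ne
      (hΛ.cosmologicalTime_mono hnp hm0 hp hC0)
    have h1 := ENNReal.toReal_mono hpt (hΛ.cosmologicalTime_mono hnp hp hm1 hC1)
    rw [hpa] at h0 h1
    obtain ⟨K, hK⟩ := hγ.lipschitz
    obtain ⟨t, ht, hta⟩ := intermediate_value_Icc' zero_le_one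
      (hcont.comp hK.continuousOn hγ.mem) ⟨h1, h0⟩
    exact hmiss t ht ⟨(mem_cosmologicalLevel_iff ha).2 ⟨hγ.mem t ht, hta⟩, hγ.mem t ht⟩

/-! ### Normal cone at the initial singularity -/

/-- The first variation at the point `r` of the closed domain farthest from `x`: the domain lies
on one side of the spacelike hyperplane through `r` orthogonal to `x - r`. -/
lemma lor_sub_le_of_maximizer {x r q : Minkowski n} (hr : r ∈ closure (futureDomain Λ))
    (hxr : FutureTimelike (x - r))
    (hmax : ∀ q ∈ closure (futureDomain Λ), x - q ∈ causalCone → lorNorm (x - q) ≤ lorNorm (x - r))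
    (hq : q ∈ closure (futureDomain Λ)) : lor (q - r) (x - r) ≤ 0 := by
  by_contra! hb
  set w := q - r with hw
  set e := x - r with he
  have h1 : ∀ᶠ s : ℝ in 𝓝[>] 0, FutureTimelike (e - s • w) := by
    have hc : Continuous fun s : ℝ => e - s • w := by fun_prop
    exact (hc.tendsto 0).eventually (isOpen_futureTimelike.mem_nhds (by simpa using hxr))
      |>.filter_mono nhdsWithin_le_nhds
  have h2 : ∀ᶠ s : ℝ in 𝓝[>] 0, 0 < 2 * lor w e - s * lor w w := by
    have hc : Continuous fun s : ℝ => 2 * lor w e - s * lor w w := by fun_prop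
    exact ((hc.tendsto 0).eventually (lt_mem_nhds (by simpa using hb))).filter_mono
      nhdsWithin_le_nhds
  obtain ⟨s, hs1, hs2, hs3⟩ :=
    (h1.and (h2.and (Ioo_mem_nhdsGT (zero_lt_one : (0 : ℝ) < 1)))).exists
  have hmem := convex_futureDomain.closure.add_smul_sub_mem hr hq ⟨hs3.1.le, hs3.2.le⟩
  have heq : x - (r + s • (q - r)) = e - s • w := by rw [he, hw]; module
  have hC := hs1.futureCausal.mem_causalCone
  have h3 := hmax _ hmem (heq ▸ hC)
  rw [heq] at h3
  have h4 := pow_le_pow_left₀ (lorNorm_nonneg _) h3 2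
  rw [sq_lorNorm hC, sq_lorNorm hxr.futureCausal.mem_causalCone] at h4
  simp only [lor_sub_left, lor_sub_right, lor_smul_left, lor_smul_right, lor_comm e w] at h4
  nlinarith [mul_pos hs3.1 hs2]

/-- Every continuous linear form is the Lorentzian product with some vector. -/
lemma exists_lor_eq (f : StrongDual ℝ (Minkowski n)) : ∃ w : Minkowski n, ∀ z, f z = lor w z := by
  refine ⟨(-f (1, 0), (InnerProductSpace.toDual ℝ _).symm
    (f.comp (ContinuousLinearMap.inr ℝ ℝ _))), fun z => ?_⟩
  have hz : z = z.1 • ((1, 0) : Minkowski n) + (0, z.2) := by ext <;> simp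
  conv_lhs => rw [hz, map_add, map_smul]
  simp [lor, mul_comm]

/-- If `⟨w, u⟩ < 0` for all hyperplanes of `Λ` through `r`, then `w` points from `r` into the
domain. -/
lemma IsFutureRegular.eventually_add_smul_mem (hΛ : IsFutureRegular Λ) {r w : Minkowski n}
    (hr : r ∈ closure (futureDomain Λ)) (hw : ∀ p ∈ Λ, lor r p.1.1 = p.2 → lor w p.1.1 < 0) :
    ∀ᶠ s : ℝ in 𝓝[>] 0, r + s • w ∈ futureDomain Λ := by
  refine hΛ.eventually_mem nhdsWithin_le_nhds (by fun_prop) fun p hp => ?_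
  rcases (lor_le_of_mem_closure hr hp).eq_or_lt with h | h
  · have hc : Continuous fun q : PenroseBoundary n => lor w q.1.1 := by fun_prop
    have h1 : ∀ᶠ q in 𝓝[Λ] p, lor w q.1.1 < 0 :=
      ((hc.tendsto p).eventually (gt_mem_nhds (hw p hp h))).filter_mono nhdsWithin_le_nhds
    have h2 : ∀ᶠ s : ℝ in 𝓝[>] 0, 0 < s := self_mem_nhdsWithin
    filter_upwards [h2.prod_mk (h1.and self_mem_nhdsWithin)] with z ⟨hz1, hz2, hz3⟩
    rw [lor_add_left, lor_smul_left]
    nlinarith [lor_le_of_mem_closure hr hz3]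
  · have hc : Continuous fun z : ℝ × PenroseBoundary n =>
        z.2.2 - lor (r + z.1 • w) z.2.1.1 := by fun_prop
    have h0 : ∀ᶠ z in 𝓝 ((0 : ℝ), p), 0 < z.2.2 - lor (r + z.1 • w) z.2.1.1 :=
      (hc.tendsto (0, p)).eventually (lt_mem_nhds (by simpa using h))
    rw [nhds_prod_eq] at h0
    exact (h0.filter_mono (prod_mono nhdsWithin_le_nhds nhdsWithin_le_nhds)).mono fun z hz => by
      simpa using hz

/-- In finite dimension the convex hull of a compact set is compact, by Carathéodory's theorem. -/
lemma isCompact_convexHull_of_isCompact {V : Type*} [NormedAddCommGroup V] [NormedSpace ℝ V]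
    [FiniteDimensional ℝ V] {A : Set V} (hA : IsCompact A) : IsCompact (convexHull ℝ A) := by
  have heq : convexHull ℝ A = ⋃ m ∈ Finset.range (Module.finrank ℝ V + 2),
      (fun wz : (Fin m → ℝ) × (Fin m → V) => ∑ i, wz.1 i • wz.2 i) ''
        (stdSimplex ℝ (Fin m) ×ˢ univ.pi fun _ => A) := by
    refine Subset.antisymm (fun x hx => ?_) (iUnion₂_subset fun m _ => ?_)
    · obtain ⟨ι, _, z, w, hz, hind, hw, hw1, rfl⟩ := eq_pos_convex_span_of_mem_convexHull hx
      have hcard := hind.card_le_finrank_succ.trans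
        (Nat.add_le_add_right (Submodule.finrank_le _) 1)
      let φ := (Fintype.equivFin ι).symm
      refine mem_biUnion (x := Fintype.card ι) (by simp; omega) ⟨(w ∘ φ, z ∘ φ),
        ⟨⟨fun i => (hw _).le, ?_⟩, fun i _ => hz (mem_range_self _)⟩, ?_⟩
      · exact (φ.sum_comp w).trans hw1
      · exact φ.sum_comp fun i => w i • z i
    · rintro _ ⟨⟨w, z⟩, ⟨hw, hz⟩, rfl⟩
      exact (convex_convexHull ℝ A).sum_mem (fun i _ => hw.1 i) hw.2
        fun i _ => subset_convexHull ℝ A (hz i (mem_univ i))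
  rw [heq]
  refine Finset.isCompact_biUnion _ fun m _ => IsCompact.image ?_ (by fun_prop)
  exact (isCompact_stdSimplex ℝ (Fin m)).prod (isCompact_univ_pi fun _ => hA)

/-- The Farkas lemma for regular domains. A timelike element `e` of the normal cone at `r` is a
positive combination of the null normals of the hyperplanes of `Λ` through `r`; what is needed is
that a positive multiple of one of them can be subtracted from `e` inside the normal cone. -/
lemma IsFutureRegular.exists_active_direction (hΛ : IsFutureRegular Λ) {r e : Minkowski n}
    (hr : r ∈ closure (futureDomain Λ)) (he : FutureTimelike e)
    (hsupp : ∀ q ∈ futureDomain Λ, lor (q - r) e ≤ 0) :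
    ∃ p ∈ Λ, lor r p.1.1 = p.2 ∧
      ∃ c : ℝ, 0 < c ∧ ∀ q ∈ futureDomain Λ, lor (q - r) (e - c • p.1.1) ≤ 0 := by
  set A : Set (Minkowski n) :=
    (fun p : PenroseBoundary n => p.1.1) '' (Λ ∩ {p | lor r p.1.1 = p.2}) with hA
  have hAc : IsCompact A := by
    have hc : Continuous fun u : NullDirection n => lor r u.1 := by fun_prop
    obtain ⟨M, hM⟩ := (isCompact_range hc).bddAbove
    refine IsCompact.image ?_ (by fun_prop)
    refine (hΛ.isCompact_sublevel M).of_isClosed_subset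
      (hΛ.isClosed.inter (isClosed_eq (by fun_prop) (by fun_prop))) fun p hp => ⟨hp.1, ?_⟩
    have h1 : lor r p.1.1 = p.2 := hp.2
    exact h1.symm.trans_le (hM (mem_range_self p.1))
  by_cases hray : ∃ s : ℝ, 0 ≤ s ∧ s • e ∈ convexHull ℝ A
  · obtain ⟨s, hs, hsA⟩ := hray
    -- The claim holds for every element of the hull, because the elements satisfying it form a
    -- convex set.
    set G : Set (Minkowski n) := {k | (∀ q ∈ futureDomain Λ, lor (q - r) k ≤ 0) ∧
      ∃ p ∈ Λ, lor r p.1.1 = p.2 ∧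
        ∃ c : ℝ, 0 < c ∧ ∀ q ∈ futureDomain Λ, lor (q - r) (k - c • p.1.1) ≤ 0} with hG
    have hGc : Convex ℝ G := by
      rintro k ⟨hk, p, hp, hpr, c, hc, hkc⟩ k' ⟨hk', p', hp', hpr', c', hc', hkc'⟩ α β hα hβ hαβ
      refine ⟨fun q hq => ?_, ?_⟩
      · rw [lor_add_right, lor_smul_right, lor_smul_right]
        nlinarith [hk q hq, hk' q hq]
      · rcases hα.eq_or_lt with h0 | h0
        · obtain rfl : β = 1 := by linarith
          refine ⟨p', hp', hpr', c', hc', fun q hq => ?_⟩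
          simpa [← h0] using hkc' q hq
        · refine ⟨p, hp, hpr, α * c, mul_pos h0 hc, fun q hq => ?_⟩
          rw [show α • k + β • k' - (α * c) • p.1.1 = α • (k - c • p.1.1) + β • k' by module,
            lor_add_right, lor_smul_right, lor_smul_right]
          nlinarith [hkc q hq, hk' q hq]
    have hAG : A ⊆ G := by
      rintro _ ⟨p, ⟨hp, hpr⟩, rfl⟩
      have hpr' : lor r p.1.1 = p.2 := hpr
      refine ⟨fun q hq => ?_, p, hp, hpr, 1, one_pos, fun q hq => by simp [lor]⟩
      rw [lor_sub_left, hpr']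
      linarith [hq p hp]
    obtain ⟨-, p, hp, hpr, c, hc, hcq⟩ := convexHull_min hAG hGc hsA
    have hspos : 0 < s := by
      refine lt_of_le_of_ne hs fun h0 => ?_
      obtain ⟨q, hq⟩ := hΛ.nonempty
      have h1 := hcq q hq
      rw [← h0, zero_smul, zero_sub, lor_neg_right, lor_smul_right, lor_sub_left, hpr] at h1
      nlinarith [hq p hp]
    refine ⟨p, hp, hpr, c / s, div_pos hc hspos, fun q hq => ?_⟩
    rw [show e - (c / s) • p.1.1 = s⁻¹ • (s • e - c • p.1.1) by
      rw [smul_sub, inv_smul_smul₀ hspos.ne', smul_smul, div_eq_inv_mul], lor_smul_right]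
    exact mul_nonpos_of_nonneg_of_nonpos (inv_nonneg.2 hs) (hcq q hq)
  · exfalso
    set R : Set (Minkowski n) := {z | ∃ s : ℝ, 0 ≤ s ∧ z = s • e} with hR
    have hRc : Convex ℝ R := by
      rintro _ ⟨s, hs, rfl⟩ _ ⟨t, ht, rfl⟩ α β hα hβ -
      exact ⟨α * s + β * t, by positivity, by module⟩
    have hRcl : IsClosed R := by
      have : R = (fun s : ℝ => s • e) '' Ici 0 := by
        ext z; simp [hR, eq_comm]
      rw [this]
      have he0 : e ≠ 0 := by rintro rfl; simpa using he.2
      exact (isClosedEmbedding_smul_left he0).isClosedMap _ isClosed_Ici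
    have hdisj : Disjoint (convexHull ℝ A) R := by
      rw [Set.disjoint_left]
      rintro _ hk ⟨s, hs, rfl⟩
      exact hray ⟨s, hs, hk⟩
    obtain ⟨f, b, b', hf1, hbb, hf2⟩ := geometric_hahn_banach_compact_closed (convex_convexHull ℝ A)
      (isCompact_convexHull_of_isCompact hAc) hRc hRcl hdisj
    obtain ⟨w, hw⟩ := exists_lor_eq f
    have hb0 : b' < 0 := by simpa using hf2 0 ⟨0, le_rfl, by simp⟩
    have hwe : 0 ≤ lor w e := by
      by_contra! hneg
      have := hf2 _ ⟨b' / lor w e, div_nonneg_of_nonpos hb0.le hneg.le, rfl⟩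
      rw [hw, lor_smul_right, div_mul_cancel₀ _ hneg.ne] at this
      exact this.false
    have hin := hΛ.eventually_add_smul_mem hr (w := w) fun p hp hpr => by
      have := hf1 p.1.1 (subset_convexHull ℝ A ⟨p, ⟨hp, hpr⟩, rfl⟩)
      rw [hw] at this
      linarith
    obtain ⟨s, hs1, hs2⟩ := (hin.and self_mem_nhdsWithin).exists
    have hs0 : (0 : ℝ) < s := hs2
    obtain ⟨ε, hε, hmem⟩ := exists_sub_mem_of_isOpen hΛ.isOpen_futureDomain hs1 e
    have h1 := hsupp _ hmem
    rw [show r + s • w - ε • e - r = s • w - ε • e by module, lor_sub_left, lor_smul_left,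
      lor_smul_left] at h1
    nlinarith [he.1, mul_nonneg hs0.le hwe]

/-- An element `N` of the normal cone at `r` bounds the cosmological time from above. -/
lemma cosmologicalTime_le_of_support {r N y : Minkowski n} (hN : FutureTimelike N)
    (hsupp : ∀ q ∈ futureDomain Λ, lor (q - r) N ≤ 0) :
    cosmologicalTime (futureDomain Λ) y ≤ ENNReal.ofReal (-lor (y - r) N / lorNorm N) := by
  refine cosmologicalTime_le fun q hq hyq => ?_
  rw [le_div_iff₀ (lorNorm_pos hN)]
  have h1 := lorNorm_mul_le hyq hN.futureCausal.mem_causalCone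
  have h2 : lor (y - r) N = lor (y - q) N + lor (q - r) N := by
    rw [← lor_add_left, sub_add_sub_cancel]
  linarith [hsupp q hq]

/-! ### Quadratic spacelike hypersurfaces -/

/-- The orthogonal complement of a unit timelike vector has an orthonormal basis, namely the image
of the standard spacelike one under a Lorentz boost. The last clause is Parseval's identity. -/
lemma exists_orthonormal_complement {e : Minkowski n} (he : lor e e = -1) (he0 : 0 < e.1) :
    ∃ b : Fin (n - 1) → Minkowski n, (∀ i, lor e (b i) = 0) ∧
      (∀ i j, lor (b i) (b j) = if i = j then 1 else 0) ∧
      ∀ k, lor e k = 0 → ∑ i, lor (b i) k ^ 2 = lor k k := by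
  set γ := e.1 with hγ
  have hp : ‖e.2‖ ^ 2 = γ ^ 2 - 1 := by
    rw [lor_self] at he; linarith
  have hγ1 : 1 + γ ≠ 0 := by positivity
  set β := EuclideanSpace.basisFun (Fin (n - 1)) ℝ with hβ
  set L : EuclideanSpace ℝ (Fin (n - 1)) → Minkowski n :=
    fun w => (inner ℝ e.2 w, w + (inner ℝ e.2 w / (1 + γ)) • e.2) with hL
  refine ⟨fun i => L (β i), fun i => ?_, fun i j => ?_, fun k hk => ?_⟩
  · simp only [hL, lor, inner_add_right, inner_smul_right, real_inner_self_eq_norm_sq, hp, ← hγ]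
    field_simp
    ring
  · have hij : inner ℝ (β i) (β j) = if i = j then 1 else 0 := by
      simpa using orthonormal_iff_ite.1 β.orthonormal i j
    rw [← hij]
    simp only [hL, lor, inner_add_right, inner_add_left, inner_smul_right, inner_smul_left,
      real_inner_self_eq_norm_sq, hp, real_inner_comm e.2 (β i), conj_trivial]
    field_simp
    ring
  · have hek : inner ℝ e.2 k.2 = γ * k.1 := by
      unfold lor at hk; linarith
    have hterm : ∀ i, lor (L (β i)) k = inner ℝ (β i) (k.2 - (k.1 / (1 + γ)) • e.2) := by
      intro i
      simp only [hL, lor, inner_sub_right, inner_add_left, inner_smul_right, inner_smul_left,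
        hek, real_inner_comm e.2 (β i), conj_trivial]
      field_simp
      ring
    have hpars := β.sum_sq_norm_inner_right (k.2 - (k.1 / (1 + γ)) • e.2)
    simp only [Real.norm_eq_abs, sq_abs] at hpars
    simp only [hterm, hpars]
    rw [norm_sub_sq_real, norm_smul, mul_pow, hp, inner_smul_right, real_inner_comm, hek, lor_self,
      Real.norm_eq_abs, sq_abs]
    field_simp
    ring

section Quadric

variable {Q : Minkowski n →L[ℝ] Minkowski n} {r : Minkowski n} {a : ℝ} {V W : Set (Minkowski n)}

/-- The quadric `⟨Q(y - r), y - r⟩ = -a²`, for a Lorentz-orthogonal projection `Q`, inside the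
open set `W`: a hyperboloid in the image of `Q` times the kernel of `Q`. -/
def quadric (Q : Minkowski n →L[ℝ] Minkowski n) (r : Minkowski n) (a : ℝ) (W : Set (Minkowski n)) :
    Set (Minkowski n) :=
  {y | y ∈ W ∧ lor (Q (y - r)) (y - r) = -a ^ 2}

lemma fderiv_quadric (hQ : ∀ z w, lor (Q z) w = lor z (Q w)) (y X : Minkowski n) :
    fderiv ℝ (fun y => lor (Q (y - r)) (y - r) + a ^ 2) y X = 2 * lor (Q (y - r)) X := by
  have h1 : HasFDerivAt (fun y => y - r) (ContinuousLinearMap.id ℝ (Minkowski n)) y :=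
    (hasFDerivAt_id y).sub_const r
  have h2 : HasFDerivAt (fun y => Q (y - r)) Q y := by
    have h := Q.hasFDerivAt.comp y h1
    rw [ContinuousLinearMap.comp_id] at h
    exact h
  have h3 := (lorCLM.hasFDerivAt_of_bilinear h2 h1).add_const (a ^ 2)
  simp only [lorCLM_apply] at h3
  rw [h3.fderiv]
  simp only [lorCLM_apply, add_apply, ContinuousLinearMap.precompR_apply,
    ContinuousLinearMap.precompL_apply, ContinuousLinearMap.compL_apply,
    ContinuousLinearMap.comp_id]
  rw [lor_comm (Q X), ← hQ]
  ring

lemma isSpacelikeDefiningFunction_quadric (hQ : ∀ z w, lor (Q z) w = lor z (Q w))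
    (hQQ : ∀ z, Q (Q z) = Q z) (ha : 0 < a) (hW : IsOpen W) (hfut : ∀ y ∈ W, 0 < (Q (y - r)).1) :
    IsSpacelikeDefiningFunction (quadric Q r a W) W
      (fun y => lor (Q (y - r)) (y - r) + a ^ 2) := by
  have hN : ∀ y ∈ quadric Q r a W, FutureTimelike (Q (y - r)) := fun y hy => by
    refine ⟨?_, hfut y hy.1⟩
    rw [hQ, hQQ, lor_comm, hy.2]
    nlinarith [sq_pos_of_pos ha]
  refine ⟨hW, ContDiff.contDiffOn ?_, ?_, fun y hy h0 => ?_, fun y hy X hX hX0 => ?_⟩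
  · simp only [← lorCLM_apply]
    fun_prop
  · ext y
    simp only [quadric, mem_inter_iff, mem_ofPred_eq]
    constructor
    · rintro ⟨⟨h, h'⟩, -⟩; exact ⟨h, by rw [h']; ring⟩
    · rintro ⟨h, h'⟩; exact ⟨⟨h, by linarith⟩, h⟩
  · have := DFunLike.congr_fun h0 (Q (y - r))
    rw [fderiv_quadric hQ, zero_apply] at this
    linarith [(hN y hy.1).1]
  · replace hX : lor (Q (y - r)) X = 0 := by
      rw [fderiv_quadric hQ] at hX; linarith
    by_contra! hle
    -- A causal vector, up to sign future oriented, is not orthogonal to a timelike one.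
    have hsq : ‖X.2‖ ≤ |X.1| := by
      rw [lor_self] at hle
      rw [← abs_norm, ← sq_le_sq]
      linarith
    rcases le_total 0 X.1 with h | h
    · rw [abs_of_nonneg h] at hsq
      exact (lor_neg (hN y hy.1) (futureCausal_of_mem hsq hX0)).ne hX
    · rw [abs_of_nonpos h] at hsq
      have hC : -X ∈ causalCone := by simpa [causalCone] using hsq
      have := lor_neg (hN y hy.1) (futureCausal_of_mem hC (neg_ne_zero.2 hX0))
      rw [lor_neg_right, hX] at this
      simp at this

lemma isSmoothSpacelikeHypersurface_quadric (hQ : ∀ z w, lor (Q z) w = lor z (Q w))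
    (hQQ : ∀ z, Q (Q z) = Q z) (ha : 0 < a) (hW : IsOpen W) (hWV : W ⊆ V)
    (hfut : ∀ y ∈ W, 0 < (Q (y - r)).1) :
    IsSmoothSpacelikeHypersurface V (quadric Q r a W) :=
  ⟨fun _ hy => hWV hy.1, fun _ hx => ⟨W, _, hx.1, hWV,
    isSpacelikeDefiningFunction_quadric hQ hQQ ha hW hfut⟩⟩

/-- The unit normal of the quadric is the restriction of the affine map `y ↦ Q(y - r) / a`. -/
lemma hasMeanCurvatureAt_quadric (hQ : ∀ z w, lor (Q z) w = lor z (Q w))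
    (hQQ : ∀ z, Q (Q z) = Q z) (ha : 0 < a) (hW : IsOpen W)
    (hfut : ∀ y ∈ W, 0 < (Q (y - r)).1) {x : Minkowski n} (hx : x ∈ quadric Q r a W)
    {b : Fin (n - 1) → Minkowski n} (hb : ∀ i, lor (Q (x - r)) (b i) = 0)
    (hbb : ∀ i j, lor (b i) (b j) = if i = j then 1 else 0) :
    HasMeanCurvatureAt (quadric Q r a W) x
      (-(a⁻¹ * ∑ i, lor (Q (b i)) (b i)) / ((n : ℝ) - 1)) := by
  refine ⟨W, _, fun y => a⁻¹ • Q (y - r), b, ⟨hx, hx.1⟩,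
    isSpacelikeDefiningFunction_quadric hQ hQQ ha hW hfut, ContDiff.contDiffOn (by fun_prop),
    fun y hy => ⟨?_, ?_, fun X hX => ?_⟩, fun i => ?_, hbb, ?_⟩
  · rw [lor_smul_left, lor_smul_right, hQ, hQQ, lor_comm, hy.1.2]
    field_simp
  · exact mul_pos (inv_pos.2 ha) (hfut y hy.2)
  · rw [fderiv_quadric hQ] at hX
    rw [lor_smul_left, show lor (Q (y - r)) X = 0 by linarith, mul_zero]
  · rw [fderiv_quadric hQ, hb, mul_zero]
  · have hd : HasFDerivAt (fun y => a⁻¹ • Q (y - r)) (a⁻¹ • Q) x := by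
      have h1 : HasFDerivAt (fun y => y - r) (ContinuousLinearMap.id ℝ (Minkowski n)) x :=
        (hasFDerivAt_id x).sub_const r
      exact (Q.hasFDerivAt.comp x h1).const_smul a⁻¹
    simp only [secondFundamentalForm, hd.fderiv]
    simp [lor_smul_left, Finset.mul_sum]

end Quadric

/-! ### Mean curvature of the level sets -/

lemma IsFutureRegular.two_le (hΛ : IsFutureRegular Λ) : 2 ≤ n := by
  by_contra! h
  obtain ⟨p, -⟩ := hΛ.nontrivial.nonempty
  have : IsEmpty (Fin (n - 1)) := by rw [show n - 1 = 0 by omega]; infer_instance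
  have h1 := p.1.norm_snd
  rw [Subsingleton.elim p.1.1.2 0, norm_zero] at h1
  exact p.1.2.2.1.ne h1

variable {a : ℝ} {x : Minkowski n}

/-- Every point `x` of a level set has an initial point `r` at Lorentzian distance `a` in its past
such that `x - r` lies in the normal cone of the domain at `r`. -/
lemma IsFutureRegular.exists_initial_point (hΛ : IsFutureRegular Λ)
    (hnp : ∃ p ∈ Λ, ∃ q ∈ Λ, p.1 ≠ q.1) (ha : 0 < a)
    (hx : x ∈ cosmologicalLevel (futureDomain Λ) a) :
    ∃ r ∈ closure (futureDomain Λ), FutureTimelike (x - r) ∧ lor (x - r) (x - r) = -a ^ 2 ∧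
      ∀ q ∈ futureDomain Λ, lor (q - r) (x - r) ≤ 0 := by
  obtain ⟨r, hr, hrt, hτ, hmax⟩ := hΛ.exists_maximizer hnp hx.1
  have h1 := ((mem_cosmologicalLevel_iff ha).1 hx).2
  rw [hτ, ENNReal.toReal_ofReal (lorNorm_nonneg _)] at h1
  have h2 := sq_lorNorm hrt.futureCausal.mem_causalCone
  rw [h1] at h2
  exact ⟨r, hr, hrt, by linarith, fun q hq =>
    lor_sub_le_of_maximizer hr hrt hmax (subset_closure hq)⟩

lemma lorNorm_eq_of_lor_self {v : Minkowski n} (ha : 0 < a) (h : lor v v = -a ^ 2) :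
    lorNorm v = a := by
  rw [lorNorm, h, neg_neg, Real.sqrt_sq ha.le]

/-- The barrier from the future is the hyperboloid of radius `a` centred at `r`. -/
lemma IsFutureRegular.genMeanCurvatureGE (hΛ : IsFutureRegular Λ)
    (hnp : ∃ p ∈ Λ, ∃ q ∈ Λ, p.1 ≠ q.1) (ha : 0 < a)
    (hx : x ∈ cosmologicalLevel (futureDomain Λ) a) :
    GenMeanCurvatureGE (futureDomain Λ) (cosmologicalLevel (futureDomain Λ) a) x (-(1 / a)) := by
  obtain ⟨r, hr, hrt, hra, -⟩ := hΛ.exists_initial_point hnp ha hx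
  have hO := hΛ.isOpen_futureDomain
  -- Restricting to the future of `m` provides, below every point of the barrier, a point of the
  -- domain with time at most `a`.
  set m := r + (1 / 2 : ℝ) • (x - r) with hm
  have hmE : m ∈ futureDomain Λ := by
    have h := convex_futureDomain.openSegment_closure_interior_subset_interior hr
      (hO.interior_eq.symm ▸ hx.1)
    rw [hO.interior_eq] at h
    exact h ⟨1 / 2, 1 / 2, by norm_num, by norm_num, by norm_num, by rw [hm]; module⟩
  have hhalf : ∀ y, FutureTimelike (y - m) → FutureTimelike (y - r) := fun y hy => by
    have := add_futureTimelike (smul_mem_causalCone (c := 1 / 2) (by norm_num)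
      hrt.futureCausal.mem_causalCone) hy
    rwa [show (1 / 2 : ℝ) • (x - r) + (y - m) = y - r by rw [hm]; module] at this
  have hxm : FutureTimelike (x - m) := by
    rw [show x - m = (1 / 2 : ℝ) • (x - r) by rw [hm]; module]
    refine ⟨?_, mul_pos (by norm_num) hrt.2⟩
    rw [lor_smul_left, lor_smul_right]
    linarith [hrt.1]
  set W := futureDomain Λ ∩ {y | FutureTimelike (y - m)} with hW
  have hWo : IsOpen W := hO.inter
    (isOpen_futureTimelike.preimage (by fun_prop : Continuous fun y => y - m))
  set Q := ContinuousLinearMap.id ℝ (Minkowski n) with hQ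
  have hfut : ∀ y ∈ W, 0 < (Q (y - r)).1 := fun y hy => (hhalf y hy.2).2
  have hxS : x ∈ quadric Q r a W := ⟨⟨hx.1, hxm⟩, hra⟩
  obtain ⟨b, hb, hbb, -⟩ := exists_orthonormal_complement (e := a⁻¹ • (x - r))
    (by rw [lor_smul_left, lor_smul_right, hra]; field_simp) (mul_pos (inv_pos.2 ha) hrt.2)
  refine ⟨futureDomain Λ, quadric Q r a W, hO, convex_futureDomain, hx.1, le_rfl,
    isSmoothSpacelikeHypersurface_quadric (fun _ _ => rfl) (fun _ => rfl) ha hWo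
      inter_subset_left hfut, hxS, fun y hy => ?_, _,
    hasMeanCurvatureAt_quadric (fun _ _ => rfl) (fun _ => rfl) ha hWo hfut hxS (b := b)
      (fun i => ?_) hbb, le_of_eq ?_⟩
  · have hyr := hhalf y hy.1.2
    have hya : lorNorm (y - r) = a := lorNorm_eq_of_lor_self ha hy.2
    have h1 := lorNorm_le_cosmologicalTime_of_mem_closure convex_futureDomain hO hy.1.1 hr
      hyr.futureCausal.mem_causalCone
    rw [hya] at h1
    have h2 := hΛ.cosmologicalTime_mono hnp hx.1 hmE hxm.futureCausal.mem_causalCone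
    rw [hx.2] at h2
    obtain ⟨z, hz, hyz, -⟩ := hΛ.exists_mem_level_between hnp ha hy.1.1 hmE
      hy.1.2.futureCausal.mem_causalCone h2 h1
    exact ⟨z, ⟨hz, hz.1⟩, causalPast_of_mem_causalCone convex_futureDomain hy.1.1 hz.1 hyz⟩
  · have := hb i
    rw [lor_smul_left] at this
    exact (mul_eq_zero.1 this).resolve_left (inv_pos.2 ha).ne'
  · have hn := hΛ.two_le
    have hn' : (2 : ℝ) ≤ n := by exact_mod_cast hn
    have hne : (n : ℝ) - 1 ≠ 0 := by linarith
    simp only [hQ, ContinuousLinearMap.id_apply, hbb, if_true, Finset.sum_const, Finset.card_univ,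
      Fintype.card_fin, nsmul_eq_mul, mul_one]
    rw [Nat.cast_sub (by omega), Nat.cast_one]
    field_simp

/-- The barrier from the past is a hyperbola of radius `a` times a Euclidean space. Its plane is
spanned by `x - r` and the normal `u` of a null hyperplane of `Λ` through `r`; for `y` near `x` the
projection of `y - r` to this plane stays in the normal cone at `r`, and so bounds the cosmological
time. -/
lemma IsFutureRegular.genMeanCurvatureLE (hΛ : IsFutureRegular Λ)
    (hnp : ∃ p ∈ Λ, ∃ q ∈ Λ, p.1 ≠ q.1) (ha : 0 < a)
    (hx : x ∈ cosmologicalLevel (futureDomain Λ) a) :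
    GenMeanCurvatureLE (futureDomain Λ) (cosmologicalLevel (futureDomain Λ) a) x
      (-(1 / (((n : ℝ) - 1) * a))) := by
  obtain ⟨r, hr, hrt, hra, hsupp⟩ := hΛ.exists_initial_point hnp ha hx
  have hO := hΛ.isOpen_futureDomain
  obtain ⟨p, hp, hpr, c, hc, hpc⟩ := hΛ.exists_active_direction hr hrt hsupp
  set u := p.1.1 with hu
  -- `e, k` is an orthonormal basis of the plane, and `u = β (e + k)`.
  obtain ⟨e, he⟩ : ∃ e, e = a⁻¹ • (x - r) := ⟨_, rfl⟩
  have hxe : x - r = a • e := by rw [he, smul_inv_smul₀ ha.ne']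
  have hee : lor e e = -1 := by
    rw [he, lor_smul_left, lor_smul_right, hra]; field_simp
  have huu : lor u u = 0 := p.1.2.1
  set β := -lor u e with hβ
  have hβ0 : 0 < β := by
    have h1 := lor_neg hrt p.1.futureCausal
    rw [hβ, he, lor_smul_right, lor_comm]
    have := mul_pos (inv_pos.2 ha) (neg_pos.2 h1)
    linarith
  have hue : lor u e = -β := by rw [hβ, neg_neg]
  obtain ⟨k, hk⟩ : ∃ k, k = β⁻¹ • u - e := ⟨_, rfl⟩
  have hek : lor e k = 0 := by
    rw [hk, lor_sub_right, lor_smul_right, hee, lor_comm, hue]; field_simp; ring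
  have hkk : lor k k = 1 := by
    simp only [hk, lor_sub_right, lor_smul_right, lor_sub_left, lor_smul_left, hee, lor_comm e u,
      hue, huu]
    field_simp; ring
  set Q : Minkowski n →L[ℝ] Minkowski n :=
    (lorCLM k).smulRight k - (lorCLM e).smulRight e with hQ
  have hQz : ∀ z, Q z = lor k z • k - lor e z • e := fun z => by simp [hQ]
  have hQs : ∀ z w, lor (Q z) w = lor z (Q w) := fun z w => by
    simp only [hQz, lor_sub_left, lor_smul_left, lor_comm z]
    ring
  have hQQ : ∀ z, Q (Q z) = Q z := fun z => by
    have h1 : lor k (Q z) = lor k z := by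
      rw [hQz, lor_sub_right, lor_smul_right, lor_smul_right, hkk, lor_comm k e, hek]; ring
    have h2 : lor e (Q z) = lor e z := by
      rw [hQz, lor_sub_right, lor_smul_right, lor_smul_right, hee, hek]; ring
    rw [hQz (Q z), h1, h2, hQz]
  have hQx : Q (x - r) = x - r := by
    rw [hQz, hxe, lor_smul_right, lor_smul_right, hee, lor_comm k e, hek]; module
  -- The coefficients of `Q (y - r)` on `x - r - c u` and on `u`.
  set A : Minkowski n → ℝ := fun y => (-lor e (y - r) - lor k (y - r)) / a with hA
  set B : Minkowski n → ℝ := fun y => A y * c + lor k (y - r) / β with hB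
  have hQAB : ∀ y, Q (y - r) = A y • (x - r - c • u) + B y • u := fun y => by
    have h1 : A y • a • e = (-lor e (y - r) - lor k (y - r)) • e := by
      rw [smul_smul, hA]; field_simp
    rw [hQz, hxe, smul_sub, h1, hB, hk]
    simp only [add_smul, div_eq_mul_inv, mul_smul]
    module
  have hAx : A x = 1 := by
    simp only [hA, hxe, lor_smul_right, hee, lor_comm k e, hek]; field_simp; ring
  have hBx : B x = c := by
    simp only [hB, hAx, hxe, lor_smul_right, lor_comm k e, hek]; ring
  set W := futureDomain Λ ∩ {y | 0 < A y ∧ 0 < B y ∧ 0 < (Q (y - r)).1} with hW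
  have hAc : Continuous A := by simp only [hA]; fun_prop
  have hBc : Continuous B := by simp only [hB]; fun_prop
  have hWo : IsOpen W := hO.inter ((isOpen_lt continuous_const hAc).inter
    ((isOpen_lt continuous_const hBc).inter (isOpen_lt continuous_const
      (continuous_fst.comp (Q.continuous.comp (continuous_id.sub continuous_const))))))
  have hfut : ∀ y ∈ W, 0 < (Q (y - r)).1 := fun y hy => hy.2.2.2
  have hxS : x ∈ quadric Q r a W :=
    ⟨⟨hx.1, by rw [hAx]; exact one_pos, by rwa [hBx], by rw [hQx]; exact hrt.2⟩, by rw [hQx, hra]⟩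
  obtain ⟨b, hb, hbb, hpars⟩ := exists_orthonormal_complement hee
    (by rw [he]; exact mul_pos (inv_pos.2 ha) hrt.2)
  refine ⟨futureDomain Λ, quadric Q r a W, hO, convex_futureDomain, hx.1, le_rfl,
    isSmoothSpacelikeHypersurface_quadric hQs hQQ ha hWo inter_subset_left hfut, hxS,
    fun y hy => ?_, _,
    hasMeanCurvatureAt_quadric hQs hQQ ha hWo hfut hxS (b := b) (fun i => ?_) hbb, le_of_eq ?_⟩
  · have hN : lor (Q (y - r)) (Q (y - r)) = -a ^ 2 := by
      rw [hQs, hQQ, lor_comm, hy.2]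
    have hNt : FutureTimelike (Q (y - r)) :=
      ⟨by rw [hN]; nlinarith [sq_pos_of_pos ha], hfut y hy.1⟩
    have h1 := cosmologicalTime_le_of_support (y := y) (r := r) hNt fun q hq => by
      rw [hQAB, lor_add_right, lor_smul_right, lor_smul_right, lor_sub_left q r u, hpr]
      have h2 := hpc q hq
      have h3 := hq p hp
      nlinarith [hy.1.2.1, hy.1.2.2.1]
    rw [lor_comm, hy.2, lorNorm_eq_of_lor_self ha hN,
      show - -a ^ 2 / a = a by field_simp] at h1
    have hC := hrt.futureCausal.mem_causalCone
    have hyE := add_mem_futureDomain hy.1.1 hC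
    have heq : y + (x - r) - y = x - r := add_sub_cancel_left _ _
    have h2 := lorNorm_le_cosmologicalTime convex_futureDomain hyE hy.1.1 (by rwa [heq])
    rw [heq, lorNorm_eq_of_lor_self ha hra] at h2
    obtain ⟨z, hz, -, hzy⟩ := hΛ.exists_mem_level_between hnp ha hyE hy.1.1 (by rwa [heq]) h1 h2
    exact ⟨z, ⟨hz, hz.1⟩, causalPast_of_mem_causalCone convex_futureDomain hz.1 hy.1.1 hzy⟩
  · rw [hQx, hxe, lor_smul_left, hb, mul_zero]
  · have hterm : ∀ i, lor (Q (b i)) (b i) = lor (b i) k ^ 2 := fun i => by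
      rw [hQz, lor_sub_left, lor_smul_left, lor_smul_left, hb, lor_comm k]; ring
    have hn' : (2 : ℝ) ≤ n := by exact_mod_cast hΛ.two_le
    have hne : (n : ℝ) - 1 ≠ 0 := by linarith
    simp only [hterm, hpars k hek, hkk]
    field_simp

end Minkowski

end

theorem theorem1p1 (n : ℕ) (Λ : Set (Minkowski.PenroseBoundary n))
    (hΛ : Minkowski.IsFutureRegular Λ) :
    (∀ x ∈ Minkowski.futureDomain Λ,
      0 < Minkowski.cosmologicalTime (Minkowski.futureDomain Λ) x) ∧
    ((∃ p ∈ Λ, ∃ q ∈ Λ, p.1 ≠ q.1) → ∀ x ∈ Minkowski.futureDomain Λ,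
      Minkowski.cosmologicalTime (Minkowski.futureDomain Λ) x < ⊤) ∧
    ∀ a : ℝ, 0 < a →
      Minkowski.IsC0SpacelikeHypersurface (Minkowski.futureDomain Λ)
        (Minkowski.cosmologicalLevel (Minkowski.futureDomain Λ) a) ∧
      ∀ x ∈ Minkowski.cosmologicalLevel (Minkowski.futureDomain Λ) a,
        Minkowski.GenMeanCurvatureGE (Minkowski.futureDomain Λ)
          (Minkowski.cosmologicalLevel (Minkowski.futureDomain Λ) a) x (-(1 / a)) ∧
        Minkowski.GenMeanCurvatureLE (Minkowski.futureDomain Λ)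
          (Minkowski.cosmologicalLevel (Minkowski.futureDomain Λ) a) x
          (-(1 / (((n : ℝ) - 1) * a))) := by
  refine ⟨fun x hx => Minkowski.cosmologicalTime_pos Minkowski.convex_futureDomain
    hΛ.isOpen_futureDomain hx, fun hnp x hx => hΛ.cosmologicalTime_lt_top hnp hx, fun a ha => ?_⟩
  by_cases hnp : ∃ p ∈ Λ, ∃ q ∈ Λ, p.1 ≠ q.1
  · exact ⟨hΛ.isC0SpacelikeHypersurface_level hnp ha, fun x hx =>
      ⟨hΛ.genMeanCurvatureGE hnp ha hx, hΛ.genMeanCurvatureLE hnp ha hx⟩⟩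
  · -- In a half-space `τ = ∞`, so the level set is empty.
    have hempty : ∀ x, x ∉ Minkowski.cosmologicalLevel (Minkowski.futureDomain Λ) a := by
      rintro x ⟨hx, h⟩
      rw [hΛ.cosmologicalTime_eq_top hnp hx] at h
      exact ENNReal.ofReal_ne_top h.symm
    exact ⟨⟨fun x hx => hx.1, fun x hx => (hempty x hx).elim⟩, fun x hx => (hempty x hx).elim⟩
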